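/- Let $\dot{\mathbb R}=\mathbb R\setminus\{0\}$ and let $$W(\dot{\mathbb R})=\bigl\{u\in H^1(\mathbb R\setminus\{0\};\mathbb C):\ |u|^2\operatorname{Log}|u|^2\in L^1(\mathbb R)\bigr\}$$ (with $0\operatorname{Log}0=0$). Here $u'$ denotes the weak derivative of $u$ on $\mathbb R\setminus\{0\}$ and $u(0\pm)$ the one-sided traces of $u$ at $0$. For $\gamma>0$, $\omega\in\mathbb R$ and $u\in W(\dot{\mathbb R})$ put $$\mathfrak t_\gamma[u]=\int_{\mathbb R}|u'|^2\,dx-\gamma^{-1}|u(0+)-u(0-)|^2,$$ $$S_{\omega,\gamma}(u)=\tfrac12\mathfrak t_\gamma[u]+\tfrac{\omega+1}{2}\|u\|_{L^2}^2-\tfrac12\int_{\mathbb R}|u|^2\operatorname{Log}|u|^2\,dx,$$ $$I_{\omega,\gamma}(u)=\mathfrak t_\gamma[u]+\omega\|u\|_{L^2}^2-\int_{\mathbb R}|u|^2\operatorname{Log}|u|^2\,dx,$$ $$d_\gamma(\omega)=\inf\{S_{\omega,\gamma}(u):u\in W(\dot{\mathbb R})\setminus\{0\},\ I_{\omega,\gamma}(u)=0\},$$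 and define the set of ground states by $$\mathcal N_{\omega,\gamma}=\{\varphi\in W(\dot{\mathbb R})\setminus\{0\}:\ S_{\omega,\gamma}(\varphi)=d_\gamma(\omega),\ I_{\omega,\gamma}(\varphi)=0\}.$$ **Proposition.** Let $\gamma>0$ and $\omega\in\mathbb R$. Every $u\in\mathcal N_{\omega,\gamma}$ has the form $u=e^{i\theta}\phi_\omega^{t_1,t_2}$ (almost everywhere), where $\theta\in\mathbb R$, $$\phi_\omega^{t_1,t_2}(x)=\begin{cases}e^{\frac{\omega+1}{2}}e^{-\frac12(x+t_1)^2},&x>0,\\ -e^{\frac{\omega+1}{2}}e^{-\frac12(x-t_2)^2},&x<0,\end{cases}$$ and $t_1,t_2>0$ satisfy $$t_1e^{-\frac12t_1^2}=t_2e^{-\frac12t_2^2},\qquad t_1^{-1}+t_2^{-1}=\gamma.$$ -/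

import Mathlib

open MeasureTheory Filter Topology Set

namespace LogNLS

/-- `g` is the weak derivative of `u` on the open set `ℝ \ {0}`: integration by parts holds against
every smooth test function whose (compact) support does not contain the origin. -/
def IsWeakDeriv (u g : ℝ → ℂ) : Prop :=
  ∀ ψ : ℝ → ℝ, ContDiff ℝ ((⊤ : ℕ∞) : WithTop ℕ∞) ψ → HasCompactSupport ψ → (0 : ℝ) ∉ tsupport ψ →
    ∫ x, deriv ψ x • u x = -∫ x, ψ x • g x

/-- `u` represents an element of the Sobolev space `H¹(ℝ \ {0}; ℂ)`: both `u` and its weak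
derivative on `ℝ \ {0}` are square integrable. -/
def MemH1 (u : ℝ → ℂ) : Prop :=
  MemLp u 2 volume ∧ ∃ g : ℝ → ℂ, MemLp g 2 volume ∧ IsWeakDeriv u g

open Classical in
/-- The square-integrable weak derivative `u'` of `u` on `ℝ \ {0}` (unique up to a null set, see
`weakDeriv_ae_eq`), and `0` if there is none. -/
noncomputable def weakDeriv (u : ℝ → ℂ) : ℝ → ℂ :=
  if h : ∃ g : ℝ → ℂ, MemLp g 2 volume ∧ IsWeakDeriv u g then h.choose else 0

/-- The trace `u(0+)`: the essential limit of `u` at `0` from the right, that is, the limit at `0+`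
of the representative of `u` that is continuous on `(0, ∞)` when `u ∈ H¹(ℝ \ {0})`. -/
noncomputable def traceRight (u : ℝ → ℂ) : ℂ :=
  limUnder (𝓝[>] (0 : ℝ) ⊓ ae volume) u

/-- The trace `u(0-)`: the essential limit of `u` at `0` from the left. -/
noncomputable def traceLeft (u : ℝ → ℂ) : ℂ :=
  limUnder (𝓝[<] (0 : ℝ) ⊓ ae volume) u

/-- The jump `u(0+) - u(0-)`. -/
noncomputable def jump (u : ℝ → ℂ) : ℂ := traceRight u - traceLeft u

/-- The form `t_γ[u, v] = Re ∫ u' conj(v') dx - γ⁻¹ Re [(u(0+) - u(0-)) conj(v(0+) - v(0-))]` of the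
`δ'`-interaction of strength `γ`, with domain `H¹(ℝ \ {0})`. -/
noncomputable def form (γ : ℝ) (u v : ℝ → ℂ) : ℝ :=
  (∫ x, weakDeriv u x * (starRingEnd ℂ) (weakDeriv v x)).re
    - γ⁻¹ * (jump u * (starRingEnd ℂ) (jump v)).re

/-- `u` represents an element of the energy space `W`: `u ∈ H¹(ℝ \ {0})` and
`|u|² log |u|² ∈ L¹(ℝ)`. -/
def MemW (u : ℝ → ℂ) : Prop :=
  MemH1 u ∧ Integrable (fun x => ‖u x‖ ^ 2 * Real.log (‖u x‖ ^ 2)) volume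

/-- The action functional `S_{ω,γ}`. -/
noncomputable def action (ω γ : ℝ) (u : ℝ → ℂ) : ℝ :=
  1 / 2 * form γ u u + (ω + 1) / 2 * (∫ x, ‖u x‖ ^ 2)
    - 1 / 2 * ∫ x, ‖u x‖ ^ 2 * Real.log (‖u x‖ ^ 2)

/-- The Nehari functional `I_{ω,γ}`. -/
noncomputable def nehari (ω γ : ℝ) (u : ℝ → ℂ) : ℝ :=
  form γ u u + ω * (∫ x, ‖u x‖ ^ 2) - ∫ x, ‖u x‖ ^ 2 * Real.log (‖u x‖ ^ 2)

/-- The Nehari manifold: the nonzero elements of `W` on which `I_{ω,γ}` vanishes. -/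
def nehariManifold (ω γ : ℝ) : Set (ℝ → ℂ) :=
  {u | MemW u ∧ ¬ u =ᵐ[volume] 0 ∧ nehari ω γ u = 0}

/-- `d_γ(ω)`, the infimum of the action on the Nehari manifold (bounded below by `0`, see
`action_nonneg`). -/
noncomputable def groundLevel (ω γ : ℝ) : ℝ :=
  sInf (action ω γ '' nehariManifold ω γ)

/-- The set `N_{ω,γ}` of ground states. -/
def groundStates (ω γ : ℝ) : Set (ℝ → ℂ) :=
  {u | MemW u ∧ ¬ u =ᵐ[volume] 0 ∧ action ω γ u = groundLevel ω γ ∧ nehari ω γ u = 0}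

/-- The two-sided Gaussian profile `φ_ω^{t₁,t₂}`; the value at the single point `x = 0` is
immaterial. -/
noncomputable def profile (ω t₁ t₂ : ℝ) (x : ℝ) : ℝ :=
  if 0 < x then Real.exp ((ω + 1) / 2) * Real.exp (-(1 / 2) * (x + t₁) ^ 2)
  else -(Real.exp ((ω + 1) / 2) * Real.exp (-(1 / 2) * (x - t₂) ^ 2))

/-- The weak derivative is well defined up to a null set. -/
theorem weakDeriv_ae_eq {u g : ℝ → ℂ} (hg : MemLp g 2 volume) (h : IsWeakDeriv u g) :
    weakDeriv u =ᵐ[volume] g := by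
  have hex : ∃ g : ℝ → ℂ, MemLp g 2 volume ∧ IsWeakDeriv u g := ⟨g, hg, h⟩
  have hw : weakDeriv u = hex.choose := by simp only [weakDeriv, dif_pos hex]
  obtain ⟨hk, hk'⟩ := hex.choose_spec
  rw [hw]
  set k := hex.choose
  have hkl : LocallyIntegrable k volume := hk.locallyIntegrable (by norm_num)
  have hgl : LocallyIntegrable g volume := hg.locallyIntegrable (by norm_num)
  have hsub : LocallyIntegrable (k - g) volume := hkl.sub hgl
  have key := isOpen_compl_singleton (x := (0 : ℝ)) |>.ae_eq_zero_of_integral_contDiff_smul_eq_zero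
    (μ := volume) (f := k - g) (hsub.locallyIntegrableOn _) (by
      intro ψ hψ hc hs
      have h0 : (0 : ℝ) ∉ tsupport ψ := fun hx => by simpa using hs hx
      have e1 := hk' ψ hψ hc h0
      have e2 := h ψ hψ hc h0
      have e3 : ∫ x, ψ x • k x = ∫ x, ψ x • g x := by
        rw [e1] at e2; exact neg_injective e2
      have i1 : Integrable (fun x => ψ x • k x) volume :=
        hkl.integrable_smul_left_of_hasCompactSupport hψ.continuous hc
      have i2 : Integrable (fun x => ψ x • g x) volume :=
        hgl.integrable_smul_left_of_hasCompactSupport hψ.continuous hc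
      simp only [Pi.sub_apply, smul_sub]
      rw [integral_sub i1 i2, e3, sub_self])
  have hne : ∀ᵐ x : ℝ, x ≠ 0 := by
    simp [ae_iff]
  filter_upwards [key, hne] with x hx hx0
  exact sub_eq_zero.mp (hx hx0)

theorem neBot_right : (𝓝[>] (0 : ℝ) ⊓ ae volume).NeBot := by
  rw [inf_neBot_iff]
  intro s hs t ht
  obtain ⟨b, hb, hbs⟩ := (mem_nhdsGT_iff_exists_Ioo_subset).1 hs
  have hb' : (0 : ℝ) < b := hb
  by_contra hne
  have hsub : Ioo (0 : ℝ) b ⊆ tᶜ := fun x hx hxt => hne ⟨x, hbs hx, hxt⟩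
  have hz : volume (Ioo (0 : ℝ) b) = 0 := measure_mono_null hsub (mem_ae_iff.1 ht)
  rw [Real.volume_Ioo, ENNReal.ofReal_eq_zero] at hz
  linarith

theorem neBot_left : (𝓝[<] (0 : ℝ) ⊓ ae volume).NeBot := by
  rw [inf_neBot_iff]
  intro s hs t ht
  obtain ⟨b, hb, hbs⟩ := (mem_nhdsLT_iff_exists_Ioo_subset).1 hs
  have hb' : b < (0 : ℝ) := hb
  by_contra hne
  have hsub : Ioo b (0 : ℝ) ⊆ tᶜ := fun x hx hxt => hne ⟨x, hbs hx, hxt⟩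
  have hz : volume (Ioo b (0 : ℝ)) = 0 := measure_mono_null hsub (mem_ae_iff.1 ht)
  rw [Real.volume_Ioo, ENNReal.ofReal_eq_zero] at hz
  linarith

/-- Essential one-sided limits at `0` are unique, so that `traceRight` picks the limit. -/
theorem traceRight_eq {u : ℝ → ℂ} {a : ℂ}
    (h : Tendsto u (𝓝[>] (0 : ℝ) ⊓ ae volume) (𝓝 a)) : traceRight u = a :=
  haveI := neBot_right
  h.limUnder_eq

/-- Essential one-sided limits at `0` are unique, so that `traceLeft` picks the limit. -/
theorem traceLeft_eq {u : ℝ → ℂ} {a : ℂ}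
    (h : Tendsto u (𝓝[<] (0 : ℝ) ⊓ ae volume) (𝓝 a)) : traceLeft u = a :=
  haveI := neBot_left
  h.limUnder_eq

/-- On the Nehari manifold the action is half the squared `L²` norm. -/
theorem action_eq_of_nehari {ω γ : ℝ} {u : ℝ → ℂ} (h : nehari ω γ u = 0) :
    action ω γ u = 1 / 2 * ∫ x, ‖u x‖ ^ 2 := by
  unfold nehari at h
  unfold action
  linarith

/-- The infimum that defines `groundLevel` is over a set that is bounded below. -/
theorem action_nonneg {ω γ : ℝ} {u : ℝ → ℂ} (h : u ∈ nehariManifold ω γ) :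
    0 ≤ action ω γ u := by
  rw [action_eq_of_nehari h.2.2]
  positivity

end LogNLS

namespace LogNLS

/-- `f` is an absolutely continuous function on `[0, X]` with derivative `f'`. -/
structure IsPrimitive {E : Type*} [NormedAddCommGroup E] [NormedSpace ℝ E]
    (f f' : ℝ → E) (X : ℝ) : Prop where
  intervalIntegrable : IntervalIntegrable f' volume 0 X
  eq_add_integral : ∀ x ∈ Icc 0 X, f x = f 0 + ∫ s in (0 : ℝ)..x, f' s

namespace IsPrimitive

section General
variable {E : Type*} [NormedAddCommGroup E] [NormedSpace ℝ E] {f f' : ℝ → E} {X : ℝ}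

theorem mono (h : IsPrimitive f f' X) {x : ℝ} (hx : x ∈ Icc 0 X) : IsPrimitive f f' x where
  intervalIntegrable := h.intervalIntegrable.mono_set (by
    rw [uIcc_of_le hx.1, uIcc_of_le (hx.1.trans hx.2)]; exact Icc_subset_Icc_right hx.2)
  eq_add_integral := fun y hy => h.eq_add_integral y ⟨hy.1, hy.2.trans hx.2⟩

theorem continuousOn (h : IsPrimitive f f' X) (hX : 0 ≤ X) : ContinuousOn f (Icc 0 X) := by
  have h1 : ContinuousOn (fun x => f 0 + ∫ s in (0 : ℝ)..x, f' s) (Icc 0 X) := by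
    have := intervalIntegral.continuousOn_primitive_interval' h.intervalIntegrable
      (left_mem_uIcc)
    rw [uIcc_of_le hX] at this
    exact continuousOn_const.add this
  exact h1.congr h.eq_add_integral

theorem integral_eq (h : IsPrimitive f f' X) (hX : 0 ≤ X) :
    ∫ s in (0 : ℝ)..X, f' s = f X - f 0 := by
  rw [h.eq_add_integral X ⟨hX, le_rfl⟩]; abel

theorem of_hasDerivAt [CompleteSpace E] (hX : 0 ≤ X) (hf : ContinuousOn f (Icc 0 X))
    (hd : ∀ x ∈ Ioo 0 X, HasDerivAt f (f' x) x) (hf' : IntervalIntegrable f' volume 0 X) :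
    IsPrimitive f f' X where
  intervalIntegrable := hf'
  eq_add_integral := fun x hx => by
    rw [intervalIntegral.integral_eq_sub_of_hasDerivAt_of_le hx.1
      (hf.mono (Icc_subset_Icc_right hx.2)) (fun y hy => hd y ⟨hy.1, hy.2.trans_le hx.2⟩)
      (hf'.mono_set (by
        rw [uIcc_of_le hx.1, uIcc_of_le hX]; exact Icc_subset_Icc_right hx.2))]
    abel

theorem map {F : Type*} [NormedAddCommGroup F] [NormedSpace ℝ F] [CompleteSpace E]
    [CompleteSpace F]
    (h : IsPrimitive f f' X) (L : E →L[ℝ] F) :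
    IsPrimitive (fun x => L (f x)) (fun x => L (f' x)) X where
  intervalIntegrable := by
    rcases h.intervalIntegrable with ⟨h1, h2⟩
    exact ⟨L.integrable_comp h1, L.integrable_comp h2⟩
  eq_add_integral := fun x hx => by
    have := (h.mono hx).intervalIntegrable
    rw [h.eq_add_integral x hx, map_add, L.intervalIntegral_comp_comm this]

theorem add {g g' : ℝ → E} (hf : IsPrimitive f f' X) (hg : IsPrimitive g g' X) :
    IsPrimitive (fun x => f x + g x) (fun x => f' x + g' x) X where
  intervalIntegrable := hf.intervalIntegrable.add hg.intervalIntegrable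
  eq_add_integral := fun x hx => by
    rw [intervalIntegral.integral_add (hf.mono hx).intervalIntegrable
      (hg.mono hx).intervalIntegrable, hf.eq_add_integral x hx, hg.eq_add_integral x hx]
    abel

end General

section Real
variable {f f' g g' : ℝ → ℝ} {X : ℝ}

theorem absolutelyContinuous (h : IsPrimitive f f' X) :
    AbsolutelyContinuousOnInterval (fun x => f 0 + ∫ s in (0 : ℝ)..x, f' s) 0 X := by
  have h1 : AbsolutelyContinuousOnInterval (fun _ : ℝ => f 0) 0 X :=
    (LipschitzWith.const (f 0)).lipschitzOnWith.absolutelyContinuousOnInterval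
  exact h1.add (h.intervalIntegrable.absolutelyContinuousOnInterval_intervalIntegral
    (left_mem_uIcc))

theorem ae_deriv (h : IsPrimitive f f' X) :
    ∀ᵐ x, x ∈ uIoc 0 X → deriv (fun x => f 0 + ∫ s in (0 : ℝ)..x, f' s) x = f' x := by
  filter_upwards [h.intervalIntegrable.ae_hasDerivAt_integral] with x hx hxX
  exact ((hx (uIoc_subset_uIcc hxX) 0 left_mem_uIcc).const_add (f 0)).deriv

theorem integral_mul_eq (hf : IsPrimitive f f' X) (hg : IsPrimitive g g' X) (hX : 0 ≤ X) :
    ∫ x in (0 : ℝ)..X, (f' x * g x + f x * g' x) = f X * g X - f 0 * g 0 := by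
  have key := (hf.absolutelyContinuous).integral_deriv_mul_eq_sub (hg.absolutelyContinuous)
  simp only [← hf.eq_add_integral X ⟨hX, le_rfl⟩, ← hg.eq_add_integral X ⟨hX, le_rfl⟩,
    intervalIntegral.integral_same, add_zero] at key
  rw [← key]
  apply intervalIntegral.integral_congr_ae
  filter_upwards [hf.ae_deriv, hg.ae_deriv] with x h1 h2 hx
  have hx' : x ∈ Icc 0 X := by rw [← uIcc_of_le hX]; exact uIoc_subset_uIcc hx
  rw [h1 hx, h2 hx, ← hf.eq_add_integral x hx', ← hg.eq_add_integral x hx']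

theorem mul (hf : IsPrimitive f f' X) (hg : IsPrimitive g g' X) (hX : 0 ≤ X) :
    IsPrimitive (fun x => f x * g x) (fun x => f' x * g x + f x * g' x) X where
  intervalIntegrable := by
    have hfc := hf.continuousOn hX
    have hgc := hg.continuousOn hX
    rw [← uIcc_of_le hX] at hfc hgc
    exact (hf.intervalIntegrable.mul_continuousOn hgc).add
      (hg.intervalIntegrable.continuousOn_mul hfc)
  eq_add_integral := fun x hx => by
    rw [(hf.mono hx).integral_mul_eq (hg.mono hx) hx.1]; ring

end Real

theorem normSq {p p' : ℝ → ℂ} {X : ℝ} (h : IsPrimitive p p' X) (hX : 0 ≤ X) :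
    IsPrimitive (fun x => ‖p x‖ ^ 2) (fun x => 2 * (p' x * (starRingEnd ℂ) (p x)).re) X := by
  have hr := h.map Complex.reCLM
  have hi := h.map Complex.imCLM
  have := (hr.mul hr hX).add (hi.mul hi hX)
  convert this using 2 with x x
  · rw [← Complex.normSq_eq_norm_sq, Complex.normSq_apply]; rfl
  · simp only [Complex.mul_re, Complex.conj_re, Complex.conj_im, Complex.reCLM_apply,
      Complex.imCLM_apply]
    ring

/-- Integration by parts against a real function vanishing at the endpoints. -/
theorem integral_smul_eq_neg {p p' : ℝ → ℂ} {ψ ψ' : ℝ → ℝ} {X : ℝ} (hp : IsPrimitive p p' X)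
    (hψ : IsPrimitive ψ ψ' X) (hX : 0 ≤ X) (h0 : ψ 0 = 0) (h1 : ψ X = 0) :
    ∫ x in (0 : ℝ)..X, ψ' x • p x = -∫ x in (0 : ℝ)..X, ψ x • p' x := by
  have hψc := hψ.continuousOn hX
  have hpc := hp.continuousOn hX
  rw [← uIcc_of_le hX] at hψc hpc
  have i1 : IntervalIntegrable (fun x => ψ' x • p x) volume 0 X :=
    hψ.intervalIntegrable.smul_continuousOn hpc
  have i2 : IntervalIntegrable (fun x => ψ x • p' x) volume 0 X :=
    hp.intervalIntegrable.continuousOn_smul hψc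
  rw [eq_neg_iff_add_eq_zero, ← intervalIntegral.integral_add i1 i2]
  have hcomp : ∀ L : ℂ →L[ℝ] ℝ, L (∫ x in (0 : ℝ)..X, (ψ' x • p x + ψ x • p' x)) = 0 := by
    intro L
    rw [← L.intervalIntegral_comp_comm (i1.add i2)]
    have := hψ.integral_mul_eq (hp.map L) hX
    simp only [map_add, map_smul, smul_eq_mul]
    rw [this, h0, h1]; ring
  apply Complex.ext
  · exact hcomp Complex.reCLM
  · exact hcomp Complex.imCLM

end IsPrimitive
/-- The Gaussian tail `∫_t^∞ exp (-s²) ds`. -/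
noncomputable def gaussTail (t : ℝ) : ℝ := ∫ s in Ioi t, Real.exp (-s ^ 2)

theorem integrable_exp_neg_sq : Integrable (fun s : ℝ => Real.exp (-s ^ 2)) := by
  simpa using integrable_exp_neg_mul_sq (b := 1) one_pos

theorem continuous_exp_neg_sq : Continuous (fun s : ℝ => Real.exp (-s ^ 2)) := by fun_prop

theorem gaussTail_eq (t : ℝ) :
    gaussTail t = gaussTail 0 - ∫ s in (0 : ℝ)..t, Real.exp (-s ^ 2) := by
  unfold gaussTail
  rw [← intervalIntegral.integral_Ioi_sub_Ioi' integrable_exp_neg_sq.integrableOn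
    integrable_exp_neg_sq.integrableOn]
  ring

theorem hasDerivAt_gaussTail (t : ℝ) : HasDerivAt gaussTail (-Real.exp (-t ^ 2)) t := by
  have h := (intervalIntegral.integral_hasDerivAt_right
    (continuous_exp_neg_sq.intervalIntegrable 0 t)
    (continuous_exp_neg_sq.stronglyMeasurableAtFilter _ _)
    continuous_exp_neg_sq.continuousAt).const_sub (gaussTail 0)
  exact h.congr_of_eventuallyEq (Eventually.of_forall gaussTail_eq)

theorem continuous_gaussTail : Continuous gaussTail :=
  continuous_iff_continuousAt.2 fun t => (hasDerivAt_gaussTail t).continuousAt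

theorem strictAnti_gaussTail : StrictAnti gaussTail :=
  strictAnti_of_hasDerivAt_neg (fun t => hasDerivAt_gaussTail t)
    (fun _ => neg_lt_zero.2 (Real.exp_pos _))

theorem gaussTail_pos (t : ℝ) : 0 < gaussTail t := by
  unfold gaussTail
  rw [setIntegral_pos_iff_support_of_nonneg_ae]
  · have : Function.support (fun s : ℝ => Real.exp (-s ^ 2)) = univ := by
      ext s; simp [(Real.exp_pos _).ne']
    rw [this]; simp
  · exact Eventually.of_forall fun s => (Real.exp_pos _).le
  · exact integrable_exp_neg_sq.integrableOn

theorem tendsto_gaussTail : Tendsto gaussTail atTop (𝓝 0) :=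
  tendsto_integral_Ioi_zero tendsto_id

theorem integrable_mul_exp_neg_sq : Integrable (fun s : ℝ => s * Real.exp (-s ^ 2)) := by
  simpa using integrable_mul_exp_neg_mul_sq (b := 1) one_pos

theorem tendsto_sq_atTop : Tendsto (fun s : ℝ => s ^ 2) atTop atTop :=
  tendsto_pow_atTop two_ne_zero

theorem two_mul_gaussTail_le (t : ℝ) : 2 * t * gaussTail t ≤ Real.exp (-t ^ 2) := by
  have h1 : ∫ s in Ioi t, -2 * (s * Real.exp (-s ^ 2)) = 0 - Real.exp (-t ^ 2) := by
    refine integral_Ioi_of_hasDerivAt_of_tendsto' (f := fun s => Real.exp (-s ^ 2))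
      (fun s _ => ?_) (integrable_mul_exp_neg_sq.integrableOn.const_mul _) ?_
    · have := ((hasDerivAt_pow 2 s).neg).exp
      refine this.congr_deriv ?_
      simp only [Pi.neg_apply]; push_cast; ring
    · exact Real.tendsto_exp_atBot.comp (tendsto_neg_atTop_atBot.comp tendsto_sq_atTop)
  rw [integral_const_mul] at h1
  have h2 : t * gaussTail t ≤ ∫ s in Ioi t, s * Real.exp (-s ^ 2) := by
    unfold gaussTail
    rw [← integral_const_mul]
    refine setIntegral_mono_on (integrable_exp_neg_sq.integrableOn.const_mul _)
      integrable_mul_exp_neg_sq.integrableOn measurableSet_Ioi fun s hs => ?_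
    exact mul_le_mul_of_nonneg_right (le_of_lt hs) (Real.exp_pos _).le
  linarith

theorem pow_four_mul_gaussTail_le {t : ℝ} (ht : 1 ≤ t) : t ^ 4 * gaussTail t ≤ 1 := by
  have h1 := two_mul_gaussTail_le t
  have h2 : Real.exp (-t ^ 2) * (t ^ 4 / 2) ≤ 1 := by
    rw [Real.exp_neg, inv_mul_le_iff₀ (Real.exp_pos _), mul_one]
    have := Real.quadratic_le_exp_of_nonneg (sq_nonneg t)
    nlinarith [sq_nonneg t]
  have h3 := gaussTail_pos t
  have h4 : 2 * t * (t ^ 4 * gaussTail t) ≤ 2 := by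
    have : 2 * t * (t ^ 4 * gaussTail t) ≤ t ^ 4 * Real.exp (-t ^ 2) := by
      calc 2 * t * (t ^ 4 * gaussTail t) = t ^ 4 * (2 * t * gaussTail t) := by ring
        _ ≤ _ := mul_le_mul_of_nonneg_left h1 (by positivity)
    linarith
  have h5 : 0 < t ^ 4 * gaussTail t := by positivity
  nlinarith

theorem exists_gaussTail_eq {c t : ℝ} (hc : 0 < c) (hct : c ≤ gaussTail t) :
    ∃ y, gaussTail y = c := by
  obtain ⟨b, hb⟩ := (tendsto_gaussTail.eventually (gt_mem_nhds hc)).exists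
  exact mem_range_of_exists_le_of_exists_ge continuous_gaussTail ⟨b, hb.le⟩ ⟨t, hct⟩

/-- The inverse of the Gaussian tail. -/
noncomputable def gaussTailInv : ℝ → ℝ := Function.invFun gaussTail

theorem gaussTailInv_gaussTail (t : ℝ) : gaussTailInv (gaussTail t) = t :=
  Function.leftInverse_invFun strictAnti_gaussTail.injective t

theorem gaussTail_gaussTailInv {c t : ℝ} (hc : 0 < c) (hct : c ≤ gaussTail t) :
    gaussTail (gaussTailInv c) = c := by
  obtain ⟨y, rfl⟩ := exists_gaussTail_eq hc hct
  rw [gaussTailInv_gaussTail]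

theorem hasDerivAt_gaussTailInv (y : ℝ) :
    HasDerivAt gaussTailInv (-Real.exp (y ^ 2)) (gaussTail y) := by
  have hnhds : ∀ᶠ c in 𝓝 (gaussTail y), gaussTail (gaussTailInv c) = c := by
    filter_upwards [lt_mem_nhds (gaussTail_pos y),
      gt_mem_nhds (strictAnti_gaussTail (sub_one_lt y))] with c h1 h2
    exact gaussTail_gaussTailInv h1 h2.le
  have hcont : ContinuousAt gaussTailInv (gaussTail y) := by
    unfold ContinuousAt
    rw [gaussTailInv_gaussTail, tendsto_order]
    refine ⟨fun a ha => ?_, fun a ha => ?_⟩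
    · filter_upwards [hnhds, gt_mem_nhds (strictAnti_gaussTail ha)] with c h1 h2
      rw [← h1] at h2
      exact strictAnti_gaussTail.lt_iff_gt.1 h2
    · filter_upwards [hnhds, lt_mem_nhds (strictAnti_gaussTail ha)] with c h1 h2
      rw [← h1] at h2
      exact strictAnti_gaussTail.lt_iff_gt.1 h2
  have := HasDerivAt.of_local_left_inverse (f := gaussTail) hcont
    (by rw [gaussTailInv_gaussTail]; exact hasDerivAt_gaussTail y)
    (neg_ne_zero.2 (Real.exp_pos _).ne') hnhds
  refine this.congr_deriv ?_
  rw [inv_neg, ← Real.exp_neg, neg_neg]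

/-- The ratio balancing the two Gaussian branches of a ground state. -/
noncomputable def tailRatio (t : ℝ) : ℝ := t ^ 2 * Real.exp (-t ^ 2) / gaussTail t

theorem continuous_tailRatio : Continuous tailRatio :=
  ((continuous_pow 2).mul continuous_exp_neg_sq).div continuous_gaussTail
    fun t => (gaussTail_pos t).ne'

theorem tendsto_tailRatio : Tendsto tailRatio atTop atTop := by
  refine tendsto_atTop_mono' atTop ?_ tendsto_id
  filter_upwards [eventually_ge_atTop 1] with t ht
  have h1 := two_mul_gaussTail_le t
  have h2 := gaussTail_pos t
  rw [id, tailRatio, le_div_iff₀ h2]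
  have h3 : 1 ≤ t ^ 2 := one_le_pow₀ ht
  have h4 : 0 < t * gaussTail t := by positivity
  nlinarith [Real.exp_pos (-t ^ 2)]

theorem tendsto_balance {γ m n : ℝ} (hγ : 0 < γ) (hm : 0 < m) :
    Tendsto (fun s => m * tailRatio s⁻¹ - n * tailRatio (γ - s)⁻¹) (𝓝[>] 0) atTop := by
  have h1 : Tendsto (fun s : ℝ => m * tailRatio s⁻¹) (𝓝[>] 0) atTop :=
    (tendsto_tailRatio.comp tendsto_inv_nhdsGT_zero).const_mul_atTop hm
  have h2 : Tendsto (fun s : ℝ => -(n * tailRatio (γ - s)⁻¹)) (𝓝[>] 0)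
      (𝓝 (-(n * tailRatio (γ - 0)⁻¹))) := by
    have : ContinuousAt (fun s : ℝ => -(n * tailRatio (γ - s)⁻¹)) 0 := by
      refine (ContinuousAt.mul continuousAt_const
        (continuous_tailRatio.continuousAt.comp ?_)).neg
      exact ContinuousAt.inv₀ (by fun_prop) (by simpa using hγ.ne')
    exact this.tendsto.mono_left nhdsWithin_le_nhds
  simpa [sub_eq_add_neg] using h1.atTop_add h2

/-- Parameters on the curve `t₁⁻¹ + t₂⁻¹ = γ` that balance two prescribed masses. -/
theorem exists_balanced {γ m n : ℝ} (hγ : 0 < γ) (hm : 0 < m) (hn : 0 < n) :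
    ∃ t₁ t₂ : ℝ, 0 < t₁ ∧ 0 < t₂ ∧ t₁⁻¹ + t₂⁻¹ = γ ∧
      m * tailRatio t₁ = n * tailRatio t₂ := by
  set h : ℝ → ℝ := fun s => m * tailRatio s⁻¹ - n * tailRatio (γ - s)⁻¹ with hh
  have hIoo : ∀ᶠ s : ℝ in 𝓝[>] 0, s ∈ Ioo 0 γ := Ioo_mem_nhdsGT hγ
  obtain ⟨a, ha, haI⟩ := (((tendsto_balance (n := n) hγ hm).eventually_ge_atTop 0).and hIoo).exists
  obtain ⟨b, hb, hbI⟩ := (((tendsto_balance (n := m) hγ hn).eventually_ge_atTop 0).and hIoo).exists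
  have hc : ContinuousOn h (Ioo 0 γ) := by
    refine (ContinuousOn.mul continuousOn_const (continuous_tailRatio.comp_continuousOn ?_)).sub
      (ContinuousOn.mul continuousOn_const (continuous_tailRatio.comp_continuousOn ?_))
    · exact continuousOn_id.inv₀ fun s hs => hs.1.ne'
    · exact ContinuousOn.inv₀ (by fun_prop) fun s hs => (sub_pos.2 hs.2).ne'
  have hb' : h (γ - b) ≤ 0 := by
    simp only [hh, sub_sub_cancel]; linarith
  obtain ⟨s, hs, hs0⟩ := isPreconnected_Ioo.intermediate_value
    (show γ - b ∈ Ioo 0 γ from ⟨by linarith [hbI.2], by linarith [hbI.1]⟩) haI hc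
    ⟨hb', ha⟩
  refine ⟨s⁻¹, (γ - s)⁻¹, inv_pos.2 hs.1, inv_pos.2 (sub_pos.2 hs.2), by simp, ?_⟩
  exact sub_eq_zero.1 hs0

/-- `p` is an element of the energy space on `[0, ∞)`, in its continuous representative, with weak
derivative `p'`. -/
structure HalfLine (p p' : ℝ → ℂ) : Prop where
  memLp : MemLp p 2 (volume.restrict (Ioi 0))
  memLp_deriv : MemLp p' 2 (volume.restrict (Ioi 0))
  eq_add_integral : ∀ x, 0 ≤ x → p x = p 0 + ∫ s in (0 : ℝ)..x, p' s
  entropy : IntegrableOn (fun x => ‖p x‖ ^ 2 * Real.log (‖p x‖ ^ 2)) (Ioi 0)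

/-- The mass of `p` on `(x, ∞)`. -/
noncomputable def tail (p : ℝ → ℂ) (x : ℝ) : ℝ := ∫ s in Ioi x, ‖p s‖ ^ 2

/-- The kinetic energy of a half line. -/
noncomputable def kinetic (p' : ℝ → ℂ) : ℝ := ∫ x in Ioi (0 : ℝ), ‖p' x‖ ^ 2

/-- The kinetic energy minus the entropy on a half line. -/
noncomputable def energy (p p' : ℝ → ℂ) : ℝ :=
  kinetic p' - ∫ x in Ioi (0 : ℝ), ‖p x‖ ^ 2 * Real.log (‖p x‖ ^ 2)

theorem tail_nonneg (p : ℝ → ℂ) (x : ℝ) : 0 ≤ tail p x :=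
  setIntegral_nonneg measurableSet_Ioi fun _ _ => by positivity

theorem kinetic_nonneg (p' : ℝ → ℂ) : 0 ≤ kinetic p' :=
  setIntegral_nonneg measurableSet_Ioi fun _ _ => by positivity

namespace HalfLine
variable {p p' : ℝ → ℂ}

theorem integrableOn_sq (h : HalfLine p p') : IntegrableOn (fun x => ‖p x‖ ^ 2) (Ioi 0) :=
  h.memLp.integrable_norm_pow (by norm_num)

theorem integrableOn_deriv_sq (h : HalfLine p p') :
    IntegrableOn (fun x => ‖p' x‖ ^ 2) (Ioi 0) :=
  h.memLp_deriv.integrable_norm_pow (by norm_num)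

theorem isPrimitive (h : HalfLine p p') {X : ℝ} (hX : 0 ≤ X) : IsPrimitive p p' X where
  intervalIntegrable := by
    rw [intervalIntegrable_iff_integrableOn_Ioc_of_le hX]
    have h1 : MemLp p' 2 (volume.restrict (Ioc 0 X)) :=
      h.memLp_deriv.mono_measure (Measure.restrict_mono Ioc_subset_Ioi_self le_rfl)
    exact h1.integrable (by norm_num)
  eq_add_integral := fun x hx => h.eq_add_integral x hx.1

theorem continuousOn (h : HalfLine p p') : ContinuousOn p (Ici 0) := by
  intro x hx
  have h1 := (h.isPrimitive (X := x + 1) (by linarith [mem_Ici.1 hx])).continuousOn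
    (by linarith [mem_Ici.1 hx]) x ⟨hx, by linarith⟩
  refine h1.mono_of_mem_nhdsWithin ?_
  rw [mem_nhdsWithin]
  exact ⟨Iio (x + 1), isOpen_Iio, by simp, fun y hy => ⟨hy.2, le_of_lt hy.1⟩⟩

theorem continuousOn_sq (h : HalfLine p p') : ContinuousOn (fun x => ‖p x‖ ^ 2) (Ici 0) :=
  h.continuousOn.norm.pow 2

theorem integrableOn_cross (h : HalfLine p p') :
    IntegrableOn (fun x => 2 * (p' x * (starRingEnd ℂ) (p x)).re) (Ioi 0) := by
  have h1 : Integrable (fun x => p' x * (starRingEnd ℂ) (p x)) (volume.restrict (Ioi 0)) :=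
    h.memLp_deriv.integrable_mul (q := 2) h.memLp.star
  exact (Complex.reCLM.integrable_comp h1).const_mul 2

theorem sq_eq_add_integral (h : HalfLine p p') {x : ℝ} (hx : 0 ≤ x) :
    ‖p x‖ ^ 2 = ‖p 0‖ ^ 2 + ∫ s in (0 : ℝ)..x, 2 * (p' s * (starRingEnd ℂ) (p s)).re :=
  ((h.isPrimitive hx).normSq hx).eq_add_integral x ⟨hx, le_rfl⟩

theorem tendsto_sq (h : HalfLine p p') : Tendsto (fun x => ‖p x‖ ^ 2) atTop (𝓝 0) := by
  have h1 : Tendsto (fun x => ‖p x‖ ^ 2) atTop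
      (𝓝 (‖p 0‖ ^ 2 + ∫ s in Ioi (0 : ℝ), 2 * (p' s * (starRingEnd ℂ) (p s)).re)) := by
    refine ((intervalIntegral_tendsto_integral_Ioi 0 h.integrableOn_cross tendsto_id).const_add
      (‖p 0‖ ^ 2)).congr' ?_
    filter_upwards [eventually_ge_atTop 0] with x hx
    exact (h.sq_eq_add_integral hx).symm
  have h2 : IntegrableAtFilter (fun x => ‖p x‖ ^ 2) atTop volume :=
    ⟨Ioi 0, Ioi_mem_atTop 0, h.integrableOn_sq⟩
  have h3 := h2.eq_zero_of_tendsto (fun s hs => by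
    obtain ⟨a, ha⟩ := mem_atTop_sets.1 hs
    exact top_le_iff.1 ((Real.volume_Ici (a := a)).symm.le.trans
      (measure_mono fun x hx => ha x hx))) h1
  rwa [h3] at h1

theorem sq_eq_neg_integral (h : HalfLine p p') {x : ℝ} (hx : 0 ≤ x) :
    ‖p x‖ ^ 2 = -∫ s in Ioi x, 2 * (p' s * (starRingEnd ℂ) (p s)).re := by
  have h1 := intervalIntegral_tendsto_integral_Ioi 0 h.integrableOn_cross tendsto_id
  have h2 : Tendsto (fun x => ‖p x‖ ^ 2 - ‖p 0‖ ^ 2) atTop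
      (𝓝 (∫ s in Ioi (0 : ℝ), 2 * (p' s * (starRingEnd ℂ) (p s)).re)) := by
    refine h1.congr' ?_
    filter_upwards [eventually_ge_atTop 0] with x hx
    rw [h.sq_eq_add_integral hx]; simp
  have h3 := tendsto_nhds_unique h2 (h.tendsto_sq.sub_const _)
  have h4 := intervalIntegral.integral_Ioi_sub_Ioi' h.integrableOn_cross
    (h.integrableOn_cross.mono_set (Ioi_subset_Ioi hx))
  rw [h.sq_eq_add_integral hx, ← h4, h3]; ring

theorem sq_sq_le (h : HalfLine p p') {x : ℝ} (hx : 0 ≤ x) :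
    (‖p x‖ ^ 2) ^ 2 ≤ 4 * kinetic p' * tail p x := by
  have hI := Ioi_subset_Ioi hx
  have key : ∀ ε : ℝ, 0 ≤ kinetic p' * (ε * ε) + -‖p x‖ ^ 2 * ε + tail p x := by
    intro ε
    have i1 := (h.integrableOn_deriv_sq.mono_set hI).const_mul (ε * ε)
    have i2 := (h.integrableOn_cross.mono_set hI).const_mul ε
    have i3 := h.integrableOn_sq.mono_set hI
    have h1 : 0 ≤ ∫ s in Ioi x, (ε * ε * ‖p' s‖ ^ 2 +
        ε * (2 * (p' s * (starRingEnd ℂ) (p s)).re) + ‖p s‖ ^ 2) := by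
      refine setIntegral_nonneg measurableSet_Ioi fun s _ => ?_
      have : ε * ε * ‖p' s‖ ^ 2 + ε * (2 * (p' s * (starRingEnd ℂ) (p s)).re) + ‖p s‖ ^ 2
          = ‖(ε : ℂ) * p' s + p s‖ ^ 2 := by
        simp only [← Complex.normSq_eq_norm_sq, Complex.normSq_apply, Complex.mul_re,
          Complex.mul_im, Complex.conj_re, Complex.conj_im, Complex.add_re, Complex.add_im,
          Complex.ofReal_re, Complex.ofReal_im]
        ring
      rw [this]; positivity
    have h0 : ∫ s in Ioi x, (ε * ε * ‖p' s‖ ^ 2 +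
        ε * (2 * (p' s * (starRingEnd ℂ) (p s)).re) + ‖p s‖ ^ 2) =
        ε * ε * (∫ s in Ioi x, ‖p' s‖ ^ 2) - ε * ‖p x‖ ^ 2 + tail p x := by
      have e1 : (∫ s in Ioi x, (ε * ε * ‖p' s‖ ^ 2 +
          ε * (2 * (p' s * (starRingEnd ℂ) (p s)).re) + ‖p s‖ ^ 2)) =
          (∫ s in Ioi x, ε * ε * ‖p' s‖ ^ 2) +
          (∫ s in Ioi x, ε * (2 * (p' s * (starRingEnd ℂ) (p s)).re)) + ∫ s in Ioi x, ‖p s‖ ^ 2 := by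
        rw [← integral_add i1 i2]; exact integral_add (i1.add i2) i3
      rw [e1, integral_const_mul, integral_const_mul ε, h.sq_eq_neg_integral hx, tail]
      ring
    have h2 : (∫ s in Ioi x, ‖p' s‖ ^ 2) ≤ kinetic p' :=
      setIntegral_mono_set h.integrableOn_deriv_sq
        (Eventually.of_forall fun s => by positivity) (LE.le.eventuallyLE hI)
    have h3 := mul_le_mul_of_nonneg_left h2 (mul_self_nonneg ε)
    linarith
  have := discrim_le_zero key
  unfold discrim at this
  linarith

theorem tail_eq (h : HalfLine p p') {x : ℝ} (hx : 0 ≤ x) :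
    tail p x = tail p 0 - ∫ s in (0 : ℝ)..x, ‖p s‖ ^ 2 := by
  unfold tail
  rw [← intervalIntegral.integral_Ioi_sub_Ioi' h.integrableOn_sq
    (h.integrableOn_sq.mono_set (Ioi_subset_Ioi hx))]
  ring

theorem tail_anti (h : HalfLine p p') {x y : ℝ} (hx : 0 ≤ x) (hxy : x ≤ y) :
    tail p y ≤ tail p x :=
  setIntegral_mono_set (h.integrableOn_sq.mono_set (Ioi_subset_Ioi hx))
    (Eventually.of_forall fun s => by positivity)
    (LE.le.eventuallyLE (Ioi_subset_Ioi hxy))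

theorem intervalIntegrable_sq (h : HalfLine p p') {X : ℝ} (hX : 0 ≤ X) :
    IntervalIntegrable (fun s => ‖p s‖ ^ 2) volume 0 X := by
  rw [intervalIntegrable_iff_integrableOn_Ioc_of_le hX]
  exact h.integrableOn_sq.mono_set Ioc_subset_Ioi_self

theorem hasDerivAt_tail (h : HalfLine p p') {x : ℝ} (hx : 0 < x) :
    HasDerivAt (tail p) (-‖p x‖ ^ 2) x := by
  have hc : ContinuousAt (fun x => ‖p x‖ ^ 2) x :=
    h.continuousOn_sq.continuousAt (Ici_mem_nhds hx)
  have h1 := (intervalIntegral.integral_hasDerivAt_right (h.intervalIntegrable_sq hx.le)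
    (ContinuousOn.stronglyMeasurableAtFilter isOpen_Ioi
      (h.continuousOn_sq.mono Ioi_subset_Ici_self) x hx) hc).const_sub (tail p 0)
  refine h1.congr_of_eventuallyEq ?_
  filter_upwards [lt_mem_nhds hx] with y hy using h.tail_eq hy.le

theorem continuousOn_tail (h : HalfLine p p') : ContinuousOn (tail p) (Ici 0) := by
  intro x hx
  rcases eq_or_lt_of_le (mem_Ici.1 hx) with rfl | hx
  · have h1 := intervalIntegral.continuousOn_primitive_interval'
      (h.intervalIntegrable_sq zero_le_one) left_mem_uIcc
    rw [uIcc_of_le zero_le_one] at h1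
    have h2 : ContinuousWithinAt (tail p) (Icc 0 1) 0 :=
      ((continuousWithinAt_const (b := tail p 0)).sub (h1 0 ⟨le_rfl, zero_le_one⟩)).congr
        (fun y hy => h.tail_eq hy.1) (h.tail_eq le_rfl)
    exact h2.mono_of_mem_nhdsWithin (Icc_mem_nhdsGE one_pos)
  · exact (h.hasDerivAt_tail hx).continuousAt.continuousWithinAt

theorem tendsto_tail : Tendsto (tail p) atTop (𝓝 0) := tendsto_integral_Ioi_zero tendsto_id

theorem exists_tail_eq (h : HalfLine p p') {c : ℝ} (hc : 0 < c) (hc' : c ≤ tail p 0) :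
    ∃ x, 0 ≤ x ∧ tail p x = c := by
  obtain ⟨b, hb, hb0⟩ := ((tendsto_tail.eventually (gt_mem_nhds hc)).and
    (eventually_ge_atTop 0)).exists
  obtain ⟨x, hx, hxc⟩ := isPreconnected_Ici.intermediate_value (mem_Ici.2 hb0)
    (mem_Ici.2 (le_refl (0 : ℝ))) h.continuousOn_tail ⟨hb.le, hc'⟩
  exact ⟨x, hx, hxc⟩

end HalfLine
/-- The monotone map pushing `|p|² dx` on `(0, ∞)` to a multiple of `exp (-s²) ds` on `(t, ∞)`. -/
noncomputable def transport (p : ℝ → ℂ) (t x : ℝ) : ℝ :=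
  gaussTailInv (gaussTail t / tail p 0 * tail p x)

/-- The derivative of `transport`. -/
noncomputable def transportDeriv (p : ℝ → ℂ) (t x : ℝ) : ℝ :=
  gaussTail t / tail p 0 * ‖p x‖ ^ 2 * Real.exp (transport p t x ^ 2)

/-- The pointwise deficit in the logarithmic Sobolev inequality. -/
noncomputable def deficit (p p' : ℝ → ℂ) (t x : ℝ) : ℝ :=
  ‖p' x‖ ^ 2 - ‖p x‖ ^ 2 * Real.log (‖p x‖ ^ 2)
    - (1 + Real.log (gaussTail t / tail p 0)) * ‖p x‖ ^ 2
    + (2 * (p' x * (starRingEnd ℂ) (p x)).re * transport p t x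
      + ‖p x‖ ^ 2 * transportDeriv p t x)

theorem norm_add_real_mul_sq (a b : ℂ) (y : ℝ) :
    ‖a + y * b‖ ^ 2 = ‖a‖ ^ 2 + y * (2 * (a * (starRingEnd ℂ) b).re) + y ^ 2 * ‖b‖ ^ 2 := by
  simp only [← Complex.normSq_eq_norm_sq, Complex.normSq_apply, Complex.mul_re,
    Complex.mul_im, Complex.conj_re, Complex.conj_im, Complex.add_re, Complex.add_im,
    Complex.ofReal_re, Complex.ofReal_im]
  ring

theorem deficit_eq {p : ℝ → ℂ} (p' : ℝ → ℂ) (hm : 0 < tail p 0) (t x : ℝ) :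
    deficit p p' t x = ‖p' x + transport p t x * p x‖ ^ 2 +
      ‖p x‖ ^ 2 * (transportDeriv p t x - 1 - Real.log (transportDeriv p t x)) := by
  rw [norm_add_real_mul_sq, deficit]
  rcases eq_or_ne (‖p x‖ ^ 2) 0 with h0 | h0
  · rw [h0]; ring
  · have hG := gaussTail_pos t
    have hlog : Real.log (transportDeriv p t x) = Real.log (gaussTail t / tail p 0) +
        Real.log (‖p x‖ ^ 2) + transport p t x ^ 2 := by
      have h1 : gaussTail t / tail p 0 ≠ 0 := (div_pos hG hm).ne'
      rw [transportDeriv, Real.log_mul (mul_ne_zero h1 h0) (Real.exp_pos _).ne',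
        Real.log_mul h1 h0, Real.log_exp]
    rw [hlog]; ring

theorem transport_term_nonneg (p : ℝ → ℂ) (hm : 0 < tail p 0) (t x : ℝ) :
    0 ≤ ‖p x‖ ^ 2 * (transportDeriv p t x - 1 - Real.log (transportDeriv p t x)) := by
  rcases eq_or_ne (‖p x‖ ^ 2) 0 with h0 | h0
  · rw [h0, zero_mul]
  · have h0' : 0 < ‖p x‖ ^ 2 := lt_of_le_of_ne (by positivity) (Ne.symm h0)
    have hpos : 0 < transportDeriv p t x :=
      mul_pos (mul_pos (div_pos (gaussTail_pos t) hm) h0') (Real.exp_pos _)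
    exact mul_nonneg h0'.le (by linarith [Real.log_le_sub_one_of_pos hpos])

theorem deficit_nonneg {p : ℝ → ℂ} (p' : ℝ → ℂ) (hm : 0 < tail p 0) (t x : ℝ) :
    0 ≤ deficit p p' t x := by
  rw [deficit_eq p' hm]
  exact add_nonneg (by positivity) (transport_term_nonneg p hm t x)

theorem eq_of_deficit_eq_zero {p p' : ℝ → ℂ} (hm : 0 < tail p 0) {t x : ℝ}
    (h : deficit p p' t x = 0) :
    p' x = -(transport p t x * p x) ∧ (p x ≠ 0 → transportDeriv p t x = 1) := by
  rw [deficit_eq p' hm] at h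
  have h1 := transport_term_nonneg p hm t x
  have h2 : 0 ≤ ‖p' x + transport p t x * p x‖ ^ 2 := by positivity
  have h3 : ‖p' x + transport p t x * p x‖ ^ 2 = 0 := by linarith
  have h4 : ‖p x‖ ^ 2 * (transportDeriv p t x - 1 - Real.log (transportDeriv p t x)) = 0 := by
    linarith
  refine ⟨eq_neg_of_add_eq_zero_left (by simpa using h3), fun hp => ?_⟩
  have h0' : 0 < ‖p x‖ ^ 2 := by positivity
  have hpos : 0 < transportDeriv p t x :=
    mul_pos (mul_pos (div_pos (gaussTail_pos t) hm) h0') (Real.exp_pos _)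
  have h5 := (mul_eq_zero.1 h4).resolve_left h0'.ne'
  by_contra hne
  linarith [Real.log_lt_sub_one_of_pos hpos hne]

namespace HalfLine
variable {p p' : ℝ → ℂ}

theorem gaussTail_transport (h : HalfLine p p') (t : ℝ) {x : ℝ} (hx : 0 ≤ x)
    (hF : 0 < tail p x) :
    gaussTail (transport p t x) = gaussTail t / tail p 0 * tail p x := by
  have hle := h.tail_anti le_rfl hx
  have hm : 0 < tail p 0 := hF.trans_le hle
  have hG := gaussTail_pos t
  refine gaussTail_gaussTailInv (t := t) (by positivity) ?_
  rw [div_mul_eq_mul_div, div_le_iff₀ hm]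
  exact mul_le_mul_of_nonneg_left hle hG.le

theorem transport_zero (hm : 0 < tail p 0) (t : ℝ) : transport p t 0 = t := by
  rw [transport, div_mul_cancel₀ _ hm.ne', gaussTailInv_gaussTail]

theorem hasDerivAt_transport (h : HalfLine p p') (t : ℝ) {x : ℝ} (hx : 0 < x)
    (hF : 0 < tail p x) : HasDerivAt (transport p t) (transportDeriv p t x) x := by
  have h1 := hasDerivAt_gaussTailInv (transport p t x)
  rw [h.gaussTail_transport t hx.le hF] at h1
  have h2 := (h.hasDerivAt_tail hx).const_mul (gaussTail t / tail p 0)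
  exact (h1.comp x h2).congr_deriv (by rw [transportDeriv]; ring)

theorem tail_pos_of_le (h : HalfLine p p') {x X : ℝ} (hx : x ∈ Icc 0 X) (hF : 0 < tail p X) :
    0 < tail p x := hF.trans_le (h.tail_anti hx.1 hx.2)

theorem continuousOn_transport (h : HalfLine p p') (t : ℝ) {X : ℝ}
    (hF : 0 < tail p X) : ContinuousOn (transport p t) (Icc 0 X) := by
  intro x hx
  have h1 := (hasDerivAt_gaussTailInv (transport p t x)).continuousAt
  rw [h.gaussTail_transport t hx.1 (h.tail_pos_of_le hx hF)] at h1
  have h2 : ContinuousWithinAt (fun x => gaussTail t / tail p 0 * tail p x) (Icc 0 X) x :=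
    continuousWithinAt_const.mul ((h.continuousOn_tail.mono Icc_subset_Ici_self) x hx)
  exact ContinuousAt.comp_continuousWithinAt (f := fun x => gaussTail t / tail p 0 * tail p x)
    (g := gaussTailInv) h1 h2

theorem isPrimitive_transport (h : HalfLine p p') (t : ℝ) {X : ℝ} (hX : 0 ≤ X)
    (hF : 0 < tail p X) : IsPrimitive (transport p t) (transportDeriv p t) X := by
  have hc := h.continuousOn_transport t hF
  refine IsPrimitive.of_hasDerivAt hX hc
    (fun x hx => h.hasDerivAt_transport t hx.1
      (h.tail_pos_of_le (Ioo_subset_Icc_self hx) hF)) ?_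
  refine ContinuousOn.intervalIntegrable_of_Icc hX ?_
  exact (continuousOn_const.mul (h.continuousOn_sq.mono Icc_subset_Ici_self)).mul
    (Real.continuous_exp.comp_continuousOn (hc.pow 2))

theorem intervalIntegrable_of_integrableOn {f : ℝ → ℝ} (hf : IntegrableOn f (Ioi 0)) {X : ℝ}
    (hX : 0 ≤ X) : IntervalIntegrable f volume 0 X := by
  rw [intervalIntegrable_iff_integrableOn_Ioc_of_le hX]
  exact hf.mono_set Ioc_subset_Ioi_self

theorem isPrimitive_sq_mul_transport (h : HalfLine p p') (t : ℝ) {X : ℝ} (hX : 0 ≤ X)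
    (hF : 0 < tail p X) :
    IsPrimitive (fun x => ‖p x‖ ^ 2 * transport p t x) (fun x =>
      2 * (p' x * (starRingEnd ℂ) (p x)).re * transport p t x
      + ‖p x‖ ^ 2 * transportDeriv p t x) X :=
  ((h.isPrimitive hX).normSq hX).mul (h.isPrimitive_transport t hX hF) hX

theorem intervalIntegrable_deficit (h : HalfLine p p') (t : ℝ) {X : ℝ} (hX : 0 ≤ X)
    (hF : 0 < tail p X) : IntervalIntegrable (deficit p p' t) volume 0 X :=
  (((intervalIntegrable_of_integrableOn h.integrableOn_deriv_sq hX).sub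
    (intervalIntegrable_of_integrableOn h.entropy hX)).sub
    ((h.intervalIntegrable_sq hX).const_mul _)).add
    (h.isPrimitive_sq_mul_transport t hX hF).intervalIntegrable

theorem integral_deficit (h : HalfLine p p') (t : ℝ) {X : ℝ} (hX : 0 ≤ X)
    (hF : 0 < tail p X) :
    ∫ x in (0 : ℝ)..X, deficit p p' t x =
      (∫ x in (0 : ℝ)..X, ‖p' x‖ ^ 2)
        - (∫ x in (0 : ℝ)..X, ‖p x‖ ^ 2 * Real.log (‖p x‖ ^ 2))
        - (1 + Real.log (gaussTail t / tail p 0)) * (tail p 0 - tail p X)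
        + (‖p X‖ ^ 2 * transport p t X - ‖p 0‖ ^ 2 * t) := by
  have i1 := intervalIntegrable_of_integrableOn h.integrableOn_deriv_sq hX
  have i2 := intervalIntegrable_of_integrableOn h.entropy hX
  have i3 := (h.intervalIntegrable_sq hX).const_mul (1 + Real.log (gaussTail t / tail p 0))
  have h4 := h.isPrimitive_sq_mul_transport t hX hF
  have e := h4.integral_eq hX
  rw [transport_zero (h.tail_pos_of_le ⟨le_rfl, hX⟩ hF)] at e
  rw [← e, h.tail_eq hX, sub_sub_cancel, ← intervalIntegral.integral_const_mul,
    ← intervalIntegral.integral_sub i1 i2, ← intervalIntegral.integral_sub (i1.sub i2) i3,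
    ← intervalIntegral.integral_add ((i1.sub i2).sub i3) h4.intervalIntegrable]
  rfl

theorem integral_deficit_mono (h : HalfLine p p') (t : ℝ) {X Y : ℝ} (hX : 0 ≤ X) (hXY : X ≤ Y)
    (hF : 0 < tail p Y) :
    ∫ x in (0 : ℝ)..X, deficit p p' t x ≤ ∫ x in (0 : ℝ)..Y, deficit p p' t x :=
  intervalIntegral.integral_mono_interval le_rfl hX hXY
    (Eventually.of_forall fun x => deficit_nonneg p'
      (h.tail_pos_of_le ⟨le_rfl, hX.trans hXY⟩ hF) t x)
    (h.intervalIntegrable_deficit t (hX.trans hXY) hF)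

theorem sq_mul_transport_pow_le (h : HalfLine p p') (t : ℝ) {x : ℝ} (hx : 0 ≤ x)
    (hF : 0 < tail p x) (hy : 1 ≤ transport p t x) :
    (‖p x‖ ^ 2 * transport p t x) ^ 4 ≤
      16 * kinetic p' ^ 2 * (tail p 0 / gaussTail t) * tail p x := by
  have h1 := pow_four_mul_gaussTail_le hy
  rw [h.gaussTail_transport t hx hF] at h1
  have hm := h.tail_pos_of_le ⟨le_rfl, hx⟩ hF
  have hG := gaussTail_pos t
  have h2 := h.sq_sq_le hx
  have h3 : ((‖p x‖ ^ 2) ^ 2) ^ 2 ≤ (4 * kinetic p' * tail p x) ^ 2 :=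
    pow_le_pow_left₀ (by positivity) h2 2
  have h4 : transport p t x ^ 4 * tail p x ≤ tail p 0 / gaussTail t := by
    rw [le_div_iff₀ hG]
    have : transport p t x ^ 4 * (gaussTail t / tail p 0 * tail p x) * tail p 0
        = transport p t x ^ 4 * tail p x * gaussTail t := by field_simp
    nlinarith
  calc (‖p x‖ ^ 2 * transport p t x) ^ 4 = ((‖p x‖ ^ 2) ^ 2) ^ 2 * transport p t x ^ 4 := by ring
    _ ≤ (4 * kinetic p' * tail p x) ^ 2 * transport p t x ^ 4 :=
        mul_le_mul_of_nonneg_right h3 (by positivity)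
    _ = 16 * kinetic p' ^ 2 * tail p x * (transport p t x ^ 4 * tail p x) := by ring
    _ ≤ 16 * kinetic p' ^ 2 * tail p x * (tail p 0 / gaussTail t) :=
        mul_le_mul_of_nonneg_left h4 (by have := kinetic_nonneg p'; positivity)
    _ = _ := by ring

/-- Points whose tails tend to zero through positive values. -/
theorem exists_seq (h : HalfLine p p') (hm : 0 < tail p 0) :
    ∃ X : ℕ → ℝ, (∀ n, 0 ≤ X n) ∧ (∀ n, 0 < tail p (X n)) ∧
      Tendsto (fun n => tail p (X n)) atTop (𝓝 0) := by
  have hex : ∀ n : ℕ, ∃ x, 0 ≤ x ∧ tail p x = tail p 0 * (1 / ((n : ℝ) + 1)) := fun n => by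
    refine h.exists_tail_eq (by positivity) ?_
    refine mul_le_of_le_one_right hm.le ?_
    rw [div_le_one (by positivity)]
    linarith [(Nat.cast_nonneg n : (0 : ℝ) ≤ n)]
  choose X hX0 hX using hex
  refine ⟨X, hX0, fun n => by rw [hX]; positivity, ?_⟩
  simp only [hX]
  simpa using tendsto_one_div_add_atTop_nhds_zero_nat.const_mul (tail p 0)

theorem tendsto_entropy (h : HalfLine p p') {X : ℕ → ℝ} (hX0 : ∀ n, 0 ≤ X n)
    (hX : Tendsto (fun n => tail p (X n)) atTop (𝓝 0)) :
    Tendsto (fun n => ∫ x in (0 : ℝ)..X n, ‖p x‖ ^ 2 * Real.log (‖p x‖ ^ 2)) atTop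
      (𝓝 (∫ x in Ioi (0 : ℝ), ‖p x‖ ^ 2 * Real.log (‖p x‖ ^ 2))) := by
  set e : ℝ → ℝ := fun x => ‖p x‖ ^ 2 * Real.log (‖p x‖ ^ 2) with he
  have h1 : ∀ n, ∫ x in (0 : ℝ)..X n, e x = ∫ x in Ioi (0 : ℝ), (Iic (X n)).indicator e x := by
    intro n
    rw [intervalIntegral.integral_of_le (hX0 n), setIntegral_indicator measurableSet_Iic,
      Ioi_inter_Iic]
  simp only [h1]
  refine tendsto_integral_of_dominated_convergence (fun x => ‖e x‖)
    (fun n => h.entropy.aestronglyMeasurable.indicator measurableSet_Iic) h.entropy.norm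
    (fun n => Eventually.of_forall fun x => norm_indicator_le_norm_self _ _) ?_
  refine (ae_restrict_iff' measurableSet_Ioi).2 (Eventually.of_forall fun x hx => ?_)
  have hx0 : 0 < x := hx
  by_cases hp : p x = 0
  · have : e x = 0 := by simp [he, hp]
    have h2 : ∀ n, (Iic (X n)).indicator e x = 0 := fun n => by
      rw [indicator_apply]; split_ifs <;> simp [this]
    simp [h2, hp]
  · have hF : 0 < tail p x := by
      by_contra hle
      have h0 : ∀ y, x ≤ y → tail p y = 0 := fun y hy =>
        le_antisymm ((h.tail_anti hx0.le hy).trans (not_lt.1 hle)) (tail_nonneg p y)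
      have h3 : HasDerivWithinAt (tail p) 0 (Ici x) x :=
        (hasDerivWithinAt_const x (Ici x) (0 : ℝ)).congr (fun y hy => h0 y hy) (h0 x le_rfl)
      have h4 := (uniqueDiffWithinAt_Ici x).eq_deriv _ (h.hasDerivAt_tail hx0).hasDerivWithinAt h3
      simp [hp] at h4
    refine tendsto_const_nhds.congr' ?_
    filter_upwards [hX.eventually (gt_mem_nhds hF)] with n hn
    rw [indicator_of_mem]
    by_contra hle
    exact absurd (h.tail_anti (hX0 n) (not_le.1 hle).le) (not_le.2 hn)

/-- The deficit over a bounded interval is at most the total deficit. -/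
theorem integral_deficit_le (h : HalfLine p p') (t : ℝ) {x : ℝ} (hx : 0 ≤ x)
    (hF : 0 < tail p x) :
    ∫ s in (0 : ℝ)..x, deficit p p' t s ≤ energy p p'
      - (1 + Real.log (gaussTail t / tail p 0)) * tail p 0 - t * ‖p 0‖ ^ 2 := by
  have hm := h.tail_pos_of_le ⟨le_rfl, hx⟩ hF
  obtain ⟨X, hX0, hXp, hX⟩ := h.exists_seq hm
  set κ := gaussTail t / tail p 0 with hκ
  have hκ0 : 0 < κ := div_pos (gaussTail_pos t) hm
  set K := 16 * kinetic p' ^ 2 * (tail p 0 / gaussTail t)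
  have hlim : Tendsto (fun n => kinetic p'
      - (∫ x in (0 : ℝ)..X n, ‖p x‖ ^ 2 * Real.log (‖p x‖ ^ 2))
      - (1 + Real.log κ) * (tail p 0 - tail p (X n))
      + (√(√(K * tail p (X n))) - ‖p 0‖ ^ 2 * t)) atTop
      (𝓝 (kinetic p' - (∫ x in Ioi (0 : ℝ), ‖p x‖ ^ 2 * Real.log (‖p x‖ ^ 2))
      - (1 + Real.log κ) * (tail p 0 - 0) + (√(√(K * 0)) - ‖p 0‖ ^ 2 * t))) := by
    refine ((tendsto_const_nhds.sub (h.tendsto_entropy hX0 hX)).sub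
      ((tendsto_const_nhds.sub hX).const_mul _)).add (Tendsto.sub_const ?_ _)
    exact (Real.continuous_sqrt.tendsto _).comp
      ((Real.continuous_sqrt.tendsto _).comp (hX.const_mul K))
  have hle : ∀ᶠ n in atTop, ∫ s in (0 : ℝ)..x, deficit p p' t s ≤ kinetic p'
      - (∫ x in (0 : ℝ)..X n, ‖p x‖ ^ 2 * Real.log (‖p x‖ ^ 2))
      - (1 + Real.log κ) * (tail p 0 - tail p (X n))
      + (√(√(K * tail p (X n))) - ‖p 0‖ ^ 2 * t) := by
    have hG1 : 0 < gaussTail 1 / κ := div_pos (gaussTail_pos 1) hκ0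
    filter_upwards [hX.eventually (gt_mem_nhds hF), hX.eventually (gt_mem_nhds hG1)] with n h1 h2
    have hxn : x ≤ X n := by
      by_contra hlt
      exact absurd (h.tail_anti (hX0 n) (not_le.1 hlt).le) (not_le.2 h1)
    have hy : 1 ≤ transport p t (X n) := by
      refine le_of_lt (strictAnti_gaussTail.lt_iff_gt.1 ?_)
      rw [h.gaussTail_transport t (hX0 n) (hXp n)]
      rwa [lt_div_iff₀' hκ0] at h2
    refine (h.integral_deficit_mono t hx hxn (hXp n)).trans ?_
    rw [h.integral_deficit t (hX0 n) (hXp n)]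
    have h3 : (∫ x in (0 : ℝ)..X n, ‖p' x‖ ^ 2) ≤ kinetic p' := by
      rw [intervalIntegral.integral_of_le (hX0 n)]
      exact setIntegral_mono_set h.integrableOn_deriv_sq
        (Eventually.of_forall fun s => by positivity) Ioc_subset_Ioi_self.eventuallyLE
    have h4 : ‖p (X n)‖ ^ 2 * transport p t (X n) ≤ √(√(K * tail p (X n))) := by
      refine Real.le_sqrt_of_sq_le (Real.le_sqrt_of_sq_le ?_)
      have := h.sq_mul_transport_pow_le t (hX0 n) (hXp n) hy
      calc _ = (‖p (X n)‖ ^ 2 * transport p t (X n)) ^ 4 := by ring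
        _ ≤ _ := this
    linarith
  refine (ge_of_tendsto hlim hle).trans (le_of_eq ?_)
  rw [mul_zero, Real.sqrt_zero, Real.sqrt_zero, energy]
  ring

/-- The sharp logarithmic Sobolev inequality on the half line with a boundary term. -/
theorem le_energy (h : HalfLine p p') (hm : 0 < tail p 0) (t : ℝ) :
    (1 + Real.log (gaussTail t / tail p 0)) * tail p 0 + t * ‖p 0‖ ^ 2 ≤ energy p p' := by
  have := h.integral_deficit_le t le_rfl hm
  rw [intervalIntegral.integral_same] at this
  linarith

theorem eq_exp_of_deriv (h : HalfLine p p') {y : ℝ → ℝ} {X : ℝ} (hX : 0 ≤ X)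
    (hy : ContinuousOn y (Icc 0 X))
    (hp : ∀ᵐ x ∂volume.restrict (Ioc 0 X), p' x = -(y x * p x)) :
    p X = p 0 * (Real.exp (-∫ s in (0 : ℝ)..X, y s) : ℝ) := by
  set Y : ℝ → ℝ := fun x => ∫ s in (0 : ℝ)..x, y s with hY
  have hyI : IntervalIntegrable y volume 0 X := hy.intervalIntegrable_of_Icc hX
  have hYd : ∀ x ∈ Ioo 0 X, HasDerivAt Y (y x) x := fun x hx =>
    intervalIntegral.integral_hasDerivAt_right
      (hyI.mono_set (by
        rw [uIcc_of_le hx.1.le, uIcc_of_le hX]; exact Icc_subset_Icc_right hx.2.le))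
      (ContinuousOn.stronglyMeasurableAtFilter isOpen_Ioo (hy.mono Ioo_subset_Icc_self) x hx)
      (hy.continuousAt (Icc_mem_nhds hx.1 hx.2))
  have hYc : ContinuousOn Y (Icc 0 X) := by
    have := intervalIntegral.continuousOn_primitive_interval' hyI left_mem_uIcc
    rwa [uIcc_of_le hX] at this
  have hE : IsPrimitive (fun x => Real.exp (Y x)) (fun x => Real.exp (Y x) * y x) X :=
    IsPrimitive.of_hasDerivAt hX (Real.continuous_exp.comp_continuousOn hYc)
      (fun x hx => (hYd x hx).exp)
      (((Real.continuous_exp.comp_continuousOn hYc).mul hy).intervalIntegrable_of_Icc hX)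
  have key : ∀ L : ℂ →L[ℝ] ℝ, L (p X) * Real.exp (Y X) = L (p 0) := by
    intro L
    have h1 := ((h.isPrimitive hX).map L).integral_mul_eq hE hX
    have h2 : ∫ x in (0 : ℝ)..X,
        (L (p' x) * Real.exp (Y x) + L (p x) * (Real.exp (Y x) * y x)) = 0 := by
      rw [intervalIntegral.integral_of_le hX]
      refine integral_eq_zero_of_ae ?_
      filter_upwards [hp] with x hx
      have : L (p' x) = -(y x * L (p x)) := by
        rw [hx, ← Complex.real_smul, map_neg, map_smul, smul_eq_mul]
      rw [this, Pi.zero_apply]; ring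
    have hY0 : Y 0 = 0 := by simp [hY]
    rw [h2, hY0, Real.exp_zero, mul_one] at h1
    linarith
  have hmul : p X * (Real.exp (Y X) : ℝ) = p 0 := by
    apply Complex.ext
    · rw [Complex.re_mul_ofReal]; exact key Complex.reCLM
    · rw [Complex.im_mul_ofReal]; exact key Complex.imCLM
  rw [← hmul, mul_assoc, ← Complex.ofReal_mul, ← Real.exp_add, add_neg_cancel, Real.exp_zero,
    Complex.ofReal_one, mul_one]

/-- Equality in the logarithmic Sobolev inequality forces a Gaussian. -/
theorem eq_gaussian_of_energy_le (h : HalfLine p p') (hm : 0 < tail p 0) (t : ℝ)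
    (he : energy p p' ≤
      (1 + Real.log (gaussTail t / tail p 0)) * tail p 0 + t * ‖p 0‖ ^ 2) :
    ∀ x, 0 ≤ x → p x = p 0 * (Real.exp (-(t * x + x ^ 2 / 2)) : ℝ) := by
  have hdef : ∀ X, 0 ≤ X → 0 < tail p X →
      ∀ᵐ x ∂volume.restrict (Ioc 0 X), deficit p p' t x = 0 := by
    intro X hX hF
    have h1 := h.integral_deficit_le t hX hF
    have h2 : ∫ x in (0 : ℝ)..X, deficit p p' t x = 0 :=
      le_antisymm (by linarith)
        (intervalIntegral.integral_nonneg hX fun x _ => deficit_nonneg p' hm t x)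
    rw [intervalIntegral.integral_of_le hX, integral_eq_zero_iff_of_nonneg
      (fun x => deficit_nonneg p' hm t x)
      ((intervalIntegrable_iff_integrableOn_Ioc_of_le hX).1
        (h.intervalIntegrable_deficit t hX hF))] at h2
    exact h2
  have hexp : ∀ X, 0 ≤ X → 0 < tail p X →
      p X = p 0 * (Real.exp (-∫ s in (0 : ℝ)..X, transport p t s) : ℝ) := by
    intro X hX hF
    refine h.eq_exp_of_deriv hX (h.continuousOn_transport t hF) ?_
    filter_upwards [hdef X hX hF] with x hx using (eq_of_deficit_eq_zero hm hx).1
  have hp0 : p 0 ≠ 0 := by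
    intro hp0
    obtain ⟨X, hX, hXm⟩ := h.exists_tail_eq (half_pos hm) (half_le_self hm.le)
    have hF : 0 < tail p X := by rw [hXm]; exact half_pos hm
    have h1 : ∫ s in (0 : ℝ)..X, ‖p s‖ ^ 2 = 0 := by
      rw [intervalIntegral.integral_of_le hX]
      refine setIntegral_eq_zero_of_forall_eq_zero fun x hx => ?_
      rw [hexp x hx.1.le (h.tail_pos_of_le (Ioc_subset_Icc_self hx) hF), hp0]
      simp
    have h2 := h.tail_eq hX
    rw [h1] at h2
    linarith
  have hne : ∀ X, 0 ≤ X → 0 < tail p X → p X ≠ 0 := by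
    intro X hX hF
    rw [hexp X hX hF]
    exact mul_ne_zero hp0 (Complex.ofReal_ne_zero.2 (Real.exp_pos _).ne')
  have hy : ∀ X, 0 ≤ X → 0 < tail p X → transport p t X = t + X := by
    intro X hX hF
    have h1 := (h.isPrimitive_transport t hX hF).integral_eq hX
    have h2 : ∫ s in (0 : ℝ)..X, transportDeriv p t s = ∫ s in (0 : ℝ)..X, (1 : ℝ) := by
      rw [intervalIntegral.integral_of_le hX, intervalIntegral.integral_of_le hX]
      refine setIntegral_congr_ae measurableSet_Ioc ?_
      have := (ae_restrict_iff' measurableSet_Ioc).1 (hdef X hX hF)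
      filter_upwards [this] with x hx hxX
      exact (eq_of_deficit_eq_zero hm (hx hxX)).2
        (hne x hxX.1.le (h.tail_pos_of_le (Ioc_subset_Icc_self hxX) hF))
    rw [h2, transport_zero hm, intervalIntegral.integral_const, smul_eq_mul] at h1
    linarith
  have hF : ∀ X, 0 ≤ X → 0 < tail p X := by
    intro X hX
    obtain ⟨Z, hZ0, hZp, hZ⟩ := h.exists_seq hm
    have hκ : 0 < gaussTail t / tail p 0 := div_pos (gaussTail_pos t) hm
    obtain ⟨n, hn⟩ := (hZ.eventually (gt_mem_nhds (div_pos (gaussTail_pos (t + X)) hκ))).exists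
    rw [lt_div_iff₀' hκ, ← h.gaussTail_transport t (hZ0 n) (hZp n), hy _ (hZ0 n) (hZp n)] at hn
    have := strictAnti_gaussTail.lt_iff_gt.1 hn
    exact h.tail_pos_of_le ⟨hX, by linarith⟩ (hZp n)
  intro x hx
  rw [hexp x hx (hF x hx)]
  have : ∫ s in (0 : ℝ)..x, transport p t s = t * x + x ^ 2 / 2 := by
    have h1 : ∫ s in (0 : ℝ)..x, transport p t s = ∫ s in (0 : ℝ)..x, (t + s) :=
      intervalIntegral.integral_congr fun s hs => by
        rw [uIcc_of_le hx] at hs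
        exact hy s hs.1 (hF s hs.1)
    rw [h1, intervalIntegral.integral_add (by simp) (by simp), integral_id,
      intervalIntegral.integral_const, smul_eq_mul]
    ring
  rw [this]

theorem sq_mul_log_const_mul (c z : ℂ) :
    ‖c * z‖ ^ 2 * Real.log (‖c * z‖ ^ 2) =
      ‖c‖ ^ 2 * (‖z‖ ^ 2 * Real.log (‖z‖ ^ 2)) + ‖c‖ ^ 2 * Real.log (‖c‖ ^ 2) * ‖z‖ ^ 2 := by
  rcases eq_or_ne c 0 with rfl | hc
  · simp
  rcases eq_or_ne z 0 with rfl | hz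
  · simp
  rw [norm_mul, mul_pow, Real.log_mul (by positivity) (by positivity)]
  ring

theorem const_mul (h : HalfLine p p') (c : ℂ) :
    HalfLine (fun x => c * p x) (fun x => c * p' x) where
  memLp := h.memLp.const_mul c
  memLp_deriv := h.memLp_deriv.const_mul c
  eq_add_integral := fun x hx => by
    rw [h.eq_add_integral x hx, intervalIntegral.integral_const_mul, mul_add]
  entropy := by
    simp only [sq_mul_log_const_mul]
    exact (h.entropy.const_mul _).add (h.integrableOn_sq.const_mul _)

end HalfLine

theorem tail_const_mul (c : ℂ) (p : ℝ → ℂ) (x : ℝ) :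
    tail (fun x => c * p x) x = ‖c‖ ^ 2 * tail p x := by
  simp only [tail, norm_mul, mul_pow, integral_const_mul]

theorem HalfLine.energy_const_mul {p p' : ℝ → ℂ} (h : HalfLine p p') (c : ℂ) :
    energy (fun x => c * p x) (fun x => c * p' x) =
      ‖c‖ ^ 2 * energy p p' - ‖c‖ ^ 2 * Real.log (‖c‖ ^ 2) * tail p 0 := by
  have h1 : kinetic (fun x => c * p' x) = ‖c‖ ^ 2 * kinetic p' := by
    simp only [kinetic, norm_mul, mul_pow, integral_const_mul]
  rw [energy, h1]
  simp only [HalfLine.sq_mul_log_const_mul]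
  rw [integral_add (h.entropy.const_mul _) (h.integrableOn_sq.const_mul _),
    integral_const_mul, integral_const_mul, energy, tail]
  ring

/-- The normalized Gaussian `exp (-(t x + x² / 2))` on the half line. -/
noncomputable def gauss (t x : ℝ) : ℂ := (Real.exp (-(t * x + x ^ 2 / 2)) : ℝ)

/-- The derivative of `gauss`. -/
noncomputable def gaussDeriv (t x : ℝ) : ℂ :=
  (-((x + t) * Real.exp (-(t * x + x ^ 2 / 2))) : ℝ)

theorem norm_gauss_sq (t x : ℝ) :
    ‖gauss t x‖ ^ 2 = Real.exp (t ^ 2) * Real.exp (-(x + t) ^ 2) := by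
  rw [gauss, Complex.norm_real, Real.norm_of_nonneg (Real.exp_pos _).le, ← Real.exp_nat_mul,
    ← Real.exp_add]
  congr 1; push_cast; ring

theorem norm_gaussDeriv_sq (t x : ℝ) :
    ‖gaussDeriv t x‖ ^ 2 = Real.exp (t ^ 2) * ((x + t) ^ 2 * Real.exp (-(x + t) ^ 2)) := by
  have h : ‖gaussDeriv t x‖ ^ 2 = (x + t) ^ 2 * ‖gauss t x‖ ^ 2 := by
    simp only [gauss, gaussDeriv, Complex.norm_real, Real.norm_eq_abs, sq_abs]
    ring
  rw [h, norm_gauss_sq]; ring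

theorem integrable_sq_mul_exp_neg_sq : Integrable (fun s : ℝ => s ^ 2 * Real.exp (-s ^ 2)) := by
  have := integrable_rpow_mul_exp_neg_mul_sq (b := 1) one_pos (s := 2) (by norm_num)
  simpa using this

theorem gauss_entropy (t x : ℝ) :
    ‖gauss t x‖ ^ 2 * Real.log (‖gauss t x‖ ^ 2) =
      t ^ 2 * ‖gauss t x‖ ^ 2 - ‖gaussDeriv t x‖ ^ 2 := by
  rw [norm_gaussDeriv_sq, norm_gauss_sq,
    Real.log_mul (Real.exp_pos _).ne' (Real.exp_pos _).ne', Real.log_exp, Real.log_exp]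
  ring

theorem integrable_norm_gauss_sq (t : ℝ) : Integrable (fun x => ‖gauss t x‖ ^ 2) := by
  simp only [norm_gauss_sq]
  exact (integrable_exp_neg_sq.comp_add_right t).const_mul _

theorem integrable_norm_gaussDeriv_sq (t : ℝ) : Integrable (fun x => ‖gaussDeriv t x‖ ^ 2) := by
  simp only [norm_gaussDeriv_sq]
  exact (integrable_sq_mul_exp_neg_sq.comp_add_right t).const_mul _

theorem continuous_gauss (t : ℝ) : Continuous (gauss t) := by
  unfold gauss; fun_prop

theorem continuous_gaussDeriv (t : ℝ) : Continuous (gaussDeriv t) := by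
  unfold gaussDeriv; fun_prop

theorem hasDerivAt_gauss (t x : ℝ) : HasDerivAt (gauss t) (gaussDeriv t x) x := by
  have h1 : HasDerivAt (fun x : ℝ => -(t * x + x ^ 2 / 2)) (-(t + x)) x := by
    have := (((hasDerivAt_id x).const_mul t).add ((hasDerivAt_pow 2 x).div_const 2)).neg
    refine this.congr_deriv ?_
    simp
  refine h1.exp.ofReal_comp.congr_deriv ?_
  rw [gaussDeriv]
  congr 1
  ring

theorem halfLine_gauss (t : ℝ) : HalfLine (gauss t) (gaussDeriv t) where
  memLp := ((memLp_two_iff_integrable_sq_norm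
    (continuous_gauss t).aestronglyMeasurable).2 (integrable_norm_gauss_sq t)).restrict _
  memLp_deriv := ((memLp_two_iff_integrable_sq_norm
    (continuous_gaussDeriv t).aestronglyMeasurable).2 (integrable_norm_gaussDeriv_sq t)).restrict _
  eq_add_integral := fun x _ => by
    rw [intervalIntegral.integral_eq_sub_of_hasDerivAt (fun y _ => hasDerivAt_gauss t y)
      ((continuous_gaussDeriv t).intervalIntegrable _ _)]
    ring
  entropy := by
    simp only [gauss_entropy]
    exact (((integrable_norm_gauss_sq t).const_mul _).sub
      (integrable_norm_gaussDeriv_sq t)).integrableOn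

theorem gauss_zero (t : ℝ) : gauss t 0 = 1 := by simp [gauss]

theorem tail_gauss (t : ℝ) : tail (gauss t) 0 = Real.exp (t ^ 2) * gaussTail t := by
  simp only [tail, norm_gauss_sq, integral_const_mul, gaussTail]
  congr 1
  have := (measurePreserving_add_right volume t).setIntegral_preimage_emb
    (measurableEmbedding_addRight t) (fun s => Real.exp (-s ^ 2)) (Ioi t)
  rwa [preimage_add_const_Ioi, sub_self] at this

theorem two_mul_kinetic_gauss (t : ℝ) :
    2 * kinetic (gaussDeriv t) = tail (gauss t) 0 + t := by
  have hd : ∀ x : ℝ, HasDerivAt (fun x => (x + t) * ‖gauss t x‖ ^ 2)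
      (‖gauss t x‖ ^ 2 - 2 * ‖gaussDeriv t x‖ ^ 2) x := by
    intro x
    have h1 : HasDerivAt (fun x : ℝ => x + t) 1 x := (hasDerivAt_id x).add_const t
    have h2 := ((h1.pow 2).neg.exp).const_mul (Real.exp (t ^ 2))
    have h3 := h1.mul h2
    rw [norm_gaussDeriv_sq, norm_gauss_sq]
    simp only [norm_gauss_sq]
    refine h3.congr_deriv ?_
    simp only [Pi.neg_apply, Pi.pow_apply]
    push_cast
    ring
  have hi : Integrable (fun x => ‖gauss t x‖ ^ 2 - 2 * ‖gaussDeriv t x‖ ^ 2) :=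
    (integrable_norm_gauss_sq t).sub ((integrable_norm_gaussDeriv_sq t).const_mul 2)
  have hint : Integrable (fun x => (x + t) * ‖gauss t x‖ ^ 2) := by
    have := (integrable_mul_exp_neg_sq.comp_add_right t).const_mul (Real.exp (t ^ 2))
    refine this.congr (Eventually.of_forall fun x => ?_)
    simp only [norm_gauss_sq]; ring
  have hlim := tendsto_zero_of_hasDerivAt_of_integrableOn_Ioi (a := 0) (fun x _ => hd x)
    hi.integrableOn hint.integrableOn
  have := integral_Ioi_of_hasDerivAt_of_tendsto' (a := 0) (fun x _ => hd x) hi.integrableOn hlim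
  rw [integral_sub (integrable_norm_gauss_sq t).integrableOn
    ((integrable_norm_gaussDeriv_sq t).const_mul 2).integrableOn, integral_const_mul,
    gauss_zero] at this
  simp only [kinetic, tail]
  simp at this
  linarith

theorem energy_gauss (t : ℝ) :
    energy (gauss t) (gaussDeriv t) = (1 - t ^ 2) * tail (gauss t) 0 + t := by
  have h : ∫ x in Ioi (0 : ℝ), ‖gauss t x‖ ^ 2 * Real.log (‖gauss t x‖ ^ 2) =
      t ^ 2 * tail (gauss t) 0 - kinetic (gaussDeriv t) := by
    simp only [gauss_entropy]
    rw [integral_sub ((integrable_norm_gauss_sq t).const_mul _).integrableOn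
      (integrable_norm_gaussDeriv_sq t).integrableOn, integral_const_mul]
    rfl
  rw [energy, h]
  linarith [two_mul_kinetic_gauss t]

/-- Gaussians attain equality in the logarithmic Sobolev inequality. -/
theorem energy_const_mul_gauss {c : ℂ} (hc : c ≠ 0) (t : ℝ) {m : ℝ}
    (hm : tail (fun x => c * gauss t x) 0 = m) :
    energy (fun x => c * gauss t x) (fun x => c * gaussDeriv t x) =
      (1 + Real.log (gaussTail t / m)) * m + t * ‖c‖ ^ 2 := by
  subst hm
  have hc' : 0 < ‖c‖ ^ 2 := by positivity
  have hG := gaussTail_pos t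
  rw [(halfLine_gauss t).energy_const_mul, energy_gauss, tail_const_mul, tail_gauss,
    show gaussTail t / (‖c‖ ^ 2 * (Real.exp (t ^ 2) * gaussTail t)) =
      (‖c‖ ^ 2 * Real.exp (t ^ 2))⁻¹ by field_simp, Real.log_inv,
    Real.log_mul hc'.ne' (Real.exp_pos _).ne', Real.log_exp]
  ring

/-- Integration by parts on the half line against a test function supported away from zero. -/
theorem integral_Ioi_deriv_smul {p p' : ℝ → ℂ} (hp : ∀ X, 0 ≤ X → IsPrimitive p p' X)
    {ψ : ℝ → ℝ} (hψ : ContDiff ℝ ((⊤ : ℕ∞) : WithTop ℕ∞) ψ) (hc : HasCompactSupport ψ)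
    (h0 : (0 : ℝ) ∉ tsupport ψ) :
    ∫ x in Ioi (0 : ℝ), deriv ψ x • p x = -∫ x in Ioi (0 : ℝ), ψ x • p' x := by
  obtain ⟨X, hX0, hX⟩ : ∃ X : ℝ, 0 ≤ X ∧ ∀ x, X ≤ x → x ∉ tsupport ψ := by
    obtain ⟨B, hB⟩ := hc.isCompact.isBounded.subset_closedBall 0
    refine ⟨|B| + 1, by positivity, fun x hx hmem => ?_⟩
    have := hB hmem
    rw [mem_closedBall_zero_iff, Real.norm_eq_abs] at this
    linarith [le_abs_self x, le_abs_self B]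
  have hz : ∀ x, X ≤ x → ψ x = 0 := fun x hx => image_eq_zero_of_notMem_tsupport (hX x hx)
  have hz' : ∀ x, X ≤ x → deriv ψ x = 0 := fun x hx =>
    image_eq_zero_of_notMem_tsupport fun hm => hX x hx (tsupport_deriv_subset (𝕜 := ℝ) hm)
  have hd : IsPrimitive ψ (deriv ψ) X :=
    IsPrimitive.of_hasDerivAt hX0 hψ.continuous.continuousOn
      (fun x _ => (hψ.differentiable (by simp)).differentiableAt.hasDerivAt)
      ((hψ.continuous_deriv (by simp)).intervalIntegrable _ _)
  have key := (hp X hX0).integral_smul_eq_neg hd hX0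
    (image_eq_zero_of_notMem_tsupport h0) (hz X le_rfl)
  rw [intervalIntegral.integral_of_le hX0, intervalIntegral.integral_of_le hX0] at key
  have hcut : ∀ (φ : ℝ → ℝ) (f : ℝ → ℂ), (∀ x, X ≤ x → φ x = 0) →
      ∫ x in Ioc 0 X, φ x • f x = ∫ x in Ioi (0 : ℝ), φ x • f x := fun φ f hφ => by
    refine (setIntegral_eq_of_subset_of_forall_sdiff_eq_zero measurableSet_Ioi
      Ioc_subset_Ioi_self fun x hx => ?_).symm
    have : X ≤ x := by
      by_contra hlt; exact hx.2 ⟨hx.1, (not_le.1 hlt).le⟩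
    simp [hφ x this]
  rwa [hcut _ _ hz, hcut _ _ hz'] at key

theorem notMem_tsupport_of_subset_Ioi {ψ : ℝ → ℝ} (hs : tsupport ψ ⊆ Ioi 0) :
    (0 : ℝ) ∉ tsupport ψ := fun h => lt_irrefl (0 : ℝ) (hs h)

theorem integral_eq_Ioi {ψ : ℝ → ℝ} (hs : tsupport ψ ⊆ Ioi 0) (f : ℝ → ℂ) :
    ∫ x, ψ x • f x = ∫ x in Ioi (0 : ℝ), ψ x • f x := by
  refine (setIntegral_eq_integral_of_forall_compl_eq_zero fun x hx => ?_).symm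
  rw [image_eq_zero_of_notMem_tsupport fun h => hx (hs h), zero_smul]

/-- A test function on `(0, ∞)` with zero mean is the derivative of a test function. -/
theorem exists_primitive_test {χ : ℝ → ℝ} (hχ : ContDiff ℝ ((⊤ : ℕ∞) : WithTop ℕ∞) χ)
    (hc : HasCompactSupport χ) (hs : tsupport χ ⊆ Ioi 0) (hint : ∫ x, χ x = 0) :
    ∃ Ψ : ℝ → ℝ, ContDiff ℝ ((⊤ : ℕ∞) : WithTop ℕ∞) Ψ ∧ HasCompactSupport Ψ ∧
      tsupport Ψ ⊆ Ioi 0 ∧ deriv Ψ = χ := by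
  obtain ⟨a, b, ha, hab⟩ : ∃ a b : ℝ, 0 < a ∧ tsupport χ ⊆ Icc a b := by
    have hK : IsCompact (insert 1 (tsupport χ)) := hc.isCompact.insert 1
    obtain ⟨a, ha⟩ := hK.exists_isLeast ⟨1, mem_insert _ _⟩
    obtain ⟨b, hb⟩ := hK.exists_isGreatest ⟨1, mem_insert _ _⟩
    refine ⟨a, b, ?_, fun x hx => ⟨ha.2 (mem_insert_of_mem _ hx), hb.2 (mem_insert_of_mem _ hx)⟩⟩
    rcases ha.1 with h | h
    · rw [h]; exact one_pos
    · exact hs h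
  have hz : ∀ x, x ∉ Icc a b → χ x = 0 := fun x hx =>
    image_eq_zero_of_notMem_tsupport fun h => hx (hab h)
  have hd : ∀ x, HasDerivAt (fun x => ∫ s in a..x, χ s) (χ x) x := fun x =>
    intervalIntegral.integral_hasDerivAt_right (hχ.continuous.intervalIntegrable _ _)
      (hχ.continuous.stronglyMeasurableAtFilter _ _) hχ.continuous.continuousAt
  have hderiv : deriv (fun x => ∫ s in a..x, χ s) = χ := funext fun x => (hd x).deriv
  have hzero : ∀ x, x ∉ Icc a b → ∫ s in a..x, χ s = 0 := by
    intro x hx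
    rcases lt_or_ge x a with h | h
    · rw [intervalIntegral.integral_symm, intervalIntegral.integral_of_le h.le,
        integral_Ioc_eq_integral_Ioo, setIntegral_eq_zero_of_forall_eq_zero, neg_zero]
      exact fun s hs => hz s fun hm => not_le.2 hs.2 hm.1
    · have hb : b < x := by
        by_contra hle; exact hx ⟨h, not_lt.1 hle⟩
      rw [intervalIntegral.integral_of_le h, ← integral_Icc_eq_integral_Ioc,
        setIntegral_eq_integral_of_forall_compl_eq_zero, hint]
      exact fun s hs => hz s fun hm => hs ⟨hm.1, hm.2.trans hb.le⟩
  have hts : tsupport (fun x => ∫ s in a..x, χ s) ⊆ Icc a b :=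
    closure_minimal (fun x hx => by
      by_contra hm; exact hx (hzero x hm)) isClosed_Icc
  refine ⟨_, ?_, HasCompactSupport.of_support_subset_isCompact isCompact_Icc
    ((subset_tsupport _).trans hts), hts.trans fun x hx => ha.trans_le hx.1, hderiv⟩
  rw [contDiff_infty_iff_deriv, hderiv]
  exact ⟨fun x => (hd x).differentiableAt, hχ⟩

/-- A function on `(0, ∞)` with vanishing weak derivative is constant. -/
theorem ae_const_of_weakDeriv_zero {w : ℝ → ℂ} (hw : LocallyIntegrable w volume)
    (h : ∀ ψ : ℝ → ℝ, ContDiff ℝ ((⊤ : ℕ∞) : WithTop ℕ∞) ψ → HasCompactSupport ψ →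
      tsupport ψ ⊆ Ioi 0 → ∫ x, deriv ψ x • w x = 0) :
    ∃ c, ∀ᵐ x : ℝ, x ∈ Ioi 0 → w x = c := by
  let B : ContDiffBump (2 : ℝ) := ⟨1 / 2, 1, by norm_num, by norm_num⟩
  set ρ : ℝ → ℝ := B.normed volume with hρ
  have hρd : ContDiff ℝ ((⊤ : ℕ∞) : WithTop ℕ∞) ρ := B.contDiff_normed
  have hρc : HasCompactSupport ρ := B.hasCompactSupport_normed
  have hρs : tsupport ρ ⊆ Ioi 0 := by
    rw [hρ, B.tsupport_normed_eq]
    intro x hx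
    rw [Metric.mem_closedBall, Real.dist_eq] at hx
    have h1 := (abs_le.1 hx).1
    have h2 : B.rOut = 1 := rfl
    rw [h2] at h1
    exact mem_Ioi.2 (by linarith)
  have hρ1 : ∫ x, ρ x = 1 := B.integral_normed
  have hint : ∀ ψ : ℝ → ℝ, Continuous ψ → HasCompactSupport ψ →
      Integrable (fun x => ψ x • w x) volume := fun ψ h1 h2 =>
    hw.integrable_smul_left_of_hasCompactSupport h1 h2
  refine ⟨∫ x, ρ x • w x, ?_⟩
  set c := ∫ x, ρ x • w x with hcdef
  have hconst : LocallyIntegrable (fun _ : ℝ => c) volume := locallyIntegrable_const c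
  have key := isOpen_Ioi.ae_eq_zero_of_integral_contDiff_smul_eq_zero (U := Ioi (0 : ℝ))
    (μ := volume) (f := fun x => w x - c) ((hw.sub hconst).locallyIntegrableOn _) (by
      intro ψ hψ hψc hψs
      have hψi : Integrable ψ volume := hψ.continuous.integrable_of_hasCompactSupport hψc
      have hρi : Integrable ρ volume := hρd.continuous.integrable_of_hasCompactSupport hρc
      obtain ⟨Ψ, h1, h2, h3, h4⟩ := exists_primitive_test
        (χ := fun x => ψ x - (∫ s, ψ s) * ρ x) (hψ.sub (contDiff_const.mul hρd))
        (hψc.sub (hρc.mul_left))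
        ((tsupport_sub ψ _).trans (union_subset hψs
          ((closure_mono (Function.support_mul_subset_right _ _)).trans hρs)))
        (by rw [integral_sub hψi (hρi.const_mul _), integral_const_mul, hρ1, mul_one, sub_self])
      have h5 := h Ψ h1 h2 h3
      rw [h4] at h5
      have e1 : ∀ x, (ψ x - (∫ s, ψ s) * ρ x) • w x
          = ψ x • w x - (∫ s, ψ s) • (ρ x • w x) := fun x => by rw [sub_smul, mul_smul]
      simp only [e1] at h5
      have hρw : Integrable (fun x => (∫ s, ψ s) • (ρ x • w x)) volume :=
        (hint ρ hρd.continuous hρc).smul (∫ s, ψ s)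
      rw [integral_sub (hint ψ hψ.continuous hψc) hρw, integral_smul] at h5
      simp only [smul_sub]
      rw [integral_sub (hint ψ hψ.continuous hψc) (hψi.smul_const c), integral_smul_const]
      exact h5)
  filter_upwards [key] with x hx hx0 using sub_eq_zero.1 (hx hx0)

/-- An `H¹` function agrees on `(0, ∞)` with a primitive of its weak derivative. -/
theorem exists_halfLine_right {u g : ℝ → ℂ} (hu : MemLp u 2 volume) (hg : MemLp g 2 volume)
    (h : IsWeakDeriv u g)
    (he : Integrable (fun x => ‖u x‖ ^ 2 * Real.log (‖u x‖ ^ 2)) volume) :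
    ∃ p, HalfLine p g ∧ ∀ᵐ x : ℝ, x ∈ Ioi 0 → u x = p x := by
  have hul : LocallyIntegrable u volume := hu.locallyIntegrable (by norm_num)
  have hgl : LocallyIntegrable g volume := hg.locallyIntegrable (by norm_num)
  have hgi : ∀ a b, IntervalIntegrable g volume a b := fun a b =>
    intervalIntegrable_iff.2
      ((hgl.integrableOn_isCompact isCompact_uIcc).mono_set uIoc_subset_uIcc)
  have hPc : Continuous fun x => ∫ s in (0 : ℝ)..x, g s :=
    intervalIntegral.continuous_primitive hgi 0
  have hprim : ∀ X, 0 ≤ X → IsPrimitive (fun x => ∫ s in (0 : ℝ)..x, g s) g X := fun X _ =>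
    ⟨hgi 0 X, fun x _ => by simp⟩
  obtain ⟨c, hc⟩ := ae_const_of_weakDeriv_zero (w := fun x => u x - ∫ s in (0 : ℝ)..x, g s)
    (hul.sub hPc.locallyIntegrable) (by
      intro ψ hψ hψc hψs
      have h0 := notMem_tsupport_of_subset_Ioi hψs
      have hds : tsupport (deriv ψ) ⊆ Ioi 0 := (tsupport_deriv_subset (𝕜 := ℝ)).trans hψs
      have hdc : Continuous (deriv ψ) := hψ.continuous_deriv (by simp)
      have e1 := h ψ hψ hψc h0
      have e2 := integral_Ioi_deriv_smul hprim hψ hψc h0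
      rw [← integral_eq_Ioi hψs, ← integral_eq_Ioi hds, ← e1] at e2
      simp only [smul_sub]
      rw [integral_sub (hul.integrable_smul_left_of_hasCompactSupport hdc hψc.deriv)
        (hPc.locallyIntegrable.integrable_smul_left_of_hasCompactSupport hdc hψc.deriv), e2,
        sub_self])
  have hae : ∀ᵐ x : ℝ, x ∈ Ioi 0 → u x = c + ∫ s in (0 : ℝ)..x, g s := by
    filter_upwards [hc] with x hx hx0
    rw [← hx hx0]; ring
  have hae' : u =ᵐ[volume.restrict (Ioi 0)] fun x => c + ∫ s in (0 : ℝ)..x, g s :=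
    (ae_restrict_iff' measurableSet_Ioi).2 hae
  refine ⟨fun x => c + ∫ s in (0 : ℝ)..x, g s, ⟨?_, hg.restrict _, fun x _ => by simp, ?_⟩, hae⟩
  · exact (memLp_congr_ae hae').1 (hu.restrict _)
  · refine he.integrableOn.congr ?_
    filter_upwards [hae'] with x hx
    rw [hx]

/-- The function equal to `f` on `(0, ∞)` and to `x ↦ g (-x)` on `(-∞, 0]`. -/
noncomputable def glue {α : Type*} (f g : ℝ → α) (x : ℝ) : α := if 0 < x then f x else g (-x)

theorem glue_of_pos {α : Type*} (f g : ℝ → α) {x : ℝ} (hx : 0 < x) : glue f g x = f x :=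
  if_pos hx

theorem glue_of_nonpos {α : Type*} (f g : ℝ → α) {x : ℝ} (hx : x ≤ 0) : glue f g x = g (-x) :=
  if_neg (not_lt.2 hx)

theorem comp_glue {α β : Type*} (F : α → β) (f g : ℝ → α) (x : ℝ) :
    F (glue f g x) = glue (fun x => F (f x)) (fun x => F (g x)) x :=
  apply_ite F _ _ _

theorem measurePreserving_neg_Iic :
    MeasurePreserving (fun x : ℝ => -x) (volume.restrict (Iic 0)) (volume.restrict (Ioi 0)) := by
  have h := (Measure.measurePreserving_neg (volume : Measure ℝ)).restrict_preimage_emb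
    (Homeomorph.neg ℝ).measurableEmbedding (Ici 0)
  have e : (Neg.neg ⁻¹' Ici 0 : Set ℝ) = Iic 0 := by ext x; simp
  rw [e, ← Measure.restrict_congr_set Ioi_ae_eq_Ici] at h
  exact h

theorem ae_iff_Ioi_Iic {P : ℝ → Prop} :
    (∀ᵐ x, P x) ↔ (∀ᵐ x : ℝ, x ∈ Ioi 0 → P x) ∧ ∀ᵐ x : ℝ, x ∈ Ioi 0 → P (-x) := by
  have hneg := Measure.measurePreserving_neg (volume : Measure ℝ)
  constructor
  · intro h
    exact ⟨h.mono fun x hx _ => hx, (hneg.quasiMeasurePreserving.ae h).mono fun x hx _ => hx⟩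
  · rintro ⟨h1, h2⟩
    have h0 : ∀ᵐ x : ℝ, x ≠ 0 := by simp [ae_iff]
    filter_upwards [h1, hneg.quasiMeasurePreserving.ae h2, h0] with x hx1 hx2 hx0
    rcases lt_or_gt_of_ne hx0 with h | h
    · simpa using hx2 (neg_pos.2 h)
    · exact hx1 h

theorem glue_ae_right {α : Type*} (f g : ℝ → α) : glue f g =ᵐ[volume.restrict (Ioi 0)] f :=
  (ae_restrict_iff' measurableSet_Ioi).2 (Eventually.of_forall fun _ hx => glue_of_pos f g hx)

theorem glue_ae_left {α : Type*} (f g : ℝ → α) :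
    glue f g =ᵐ[volume.restrict (Iic 0)] fun x => g (-x) :=
  (ae_restrict_iff' measurableSet_Iic).2 (Eventually.of_forall fun _ hx => glue_of_nonpos f g hx)

section Integral
variable {E : Type*} [NormedAddCommGroup E] {f g : ℝ → E}

theorem integrable_glue (hf : IntegrableOn f (Ioi 0)) (hg : IntegrableOn g (Ioi 0)) :
    Integrable (glue f g) := by
  rw [← integrableOn_univ, ← Iic_union_Ioi (a := (0 : ℝ)), integrableOn_union]
  refine ⟨?_, Integrable.congr hf (glue_ae_right f g).symm⟩
  have : Integrable (fun x => g (-x)) (volume.restrict (Iic 0)) :=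
    measurePreserving_neg_Iic.integrable_comp_of_integrable hg
  exact this.congr (glue_ae_left f g).symm

theorem integral_glue [NormedSpace ℝ E] (hf : IntegrableOn f (Ioi 0))
    (hg : IntegrableOn g (Ioi 0)) :
    ∫ x, glue f g x = (∫ x in Ioi (0 : ℝ), f x) + ∫ x in Ioi (0 : ℝ), g x := by
  have hi := integrable_glue hf hg
  rw [← intervalIntegral.integral_Iic_add_Ioi (b := 0) hi.integrableOn hi.integrableOn,
    integral_congr_ae (glue_ae_right f g), integral_congr_ae (glue_ae_left f g),
    integral_comp_neg_Iic, neg_zero, add_comm]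

theorem memLp_glue (hf : MemLp f 2 (volume.restrict (Ioi 0)))
    (hg : MemLp g 2 (volume.restrict (Ioi 0))) : MemLp (glue f g) 2 volume := by
  have hm : AEStronglyMeasurable (glue f g) volume := by
    rw [← Measure.restrict_univ (μ := volume), ← Iic_union_Ioi (a := (0 : ℝ)),
      aestronglyMeasurable_union_iff]
    refine ⟨?_, hf.1.congr (glue_ae_right f g).symm⟩
    exact (hg.1.comp_measurePreserving measurePreserving_neg_Iic).congr (glue_ae_left f g).symm
  rw [memLp_two_iff_integrable_sq_norm hm]
  simp only [comp_glue fun z : E => ‖z‖ ^ 2]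
  exact integrable_glue (hf.integrable_norm_pow (by norm_num))
    (hg.integrable_norm_pow (by norm_num))

end Integral

theorem isWeakDeriv_comp_neg {u g : ℝ → ℂ} (h : IsWeakDeriv u g) :
    IsWeakDeriv (fun x => u (-x)) (fun x => -g (-x)) := by
  intro ψ hψ hc h0
  have hts : tsupport (fun x => ψ (-x)) = -tsupport ψ :=
    tsupport_comp_eq_preimage ψ (Homeomorph.neg ℝ)
  have h1 := h (fun x => ψ (-x)) (hψ.comp contDiff_neg)
    (hc.comp_homeomorph (Homeomorph.neg ℝ)) (by rw [hts]; simpa using h0)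
  have hd : ∀ x, deriv (fun x => ψ (-x)) x = -deriv ψ (-x) := fun x => deriv_comp_neg ψ x
  simp only [hd, neg_smul, integral_neg, neg_inj] at h1
  rw [← integral_neg_eq_self (fun x => deriv ψ x • u (-x)),
    ← integral_neg_eq_self (fun x => ψ x • -g (-x))]
  simp only [neg_neg, smul_neg, integral_neg]
  exact h1

theorem MemW.exists_glue {u : ℝ → ℂ} (h : MemW u) :
    ∃ p p' q q', HalfLine p p' ∧ HalfLine q q' ∧ u =ᵐ[volume] glue p q := by
  obtain ⟨⟨hu, g, hg, hw⟩, he⟩ := h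
  have hneg := Measure.measurePreserving_neg (volume : Measure ℝ)
  obtain ⟨p, hp, hup⟩ := exists_halfLine_right hu hg hw he
  obtain ⟨q, hq, huq⟩ := exists_halfLine_right (hu.comp_measurePreserving hneg)
    (hg.comp_measurePreserving hneg).neg (isWeakDeriv_comp_neg hw)
    (hneg.integrable_comp_of_integrable he)
  refine ⟨p, g, q, _, hp, hq, ae_iff_Ioi_Iic.2 ⟨?_, ?_⟩⟩
  · filter_upwards [hup] with x hx hx0
    rw [hx hx0, glue_of_pos _ _ hx0]
  · filter_upwards [huq] with x hx hx0
    rw [glue_of_nonpos _ _ (neg_nonpos.2 (le_of_lt hx0)), neg_neg]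
    exact hx hx0

section Glue
variable {p p' q q' : ℝ → ℂ}

theorem isWeakDeriv_glue (hp : HalfLine p p') (hq : HalfLine q q') :
    IsWeakDeriv (glue p q) (glue p' fun x => -q' x) := by
  intro ψ hψ hc h0
  have hdc : Continuous (deriv ψ) := hψ.continuous_deriv (by simp)
  have hl : LocallyIntegrable (glue p q) volume :=
    (memLp_glue hp.memLp hq.memLp).locallyIntegrable (by norm_num)
  have hl' : LocallyIntegrable (glue p' fun x => -q' x) volume :=
    (memLp_glue hp.memLp_deriv hq.memLp_deriv.neg).locallyIntegrable (by norm_num)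
  have hi := hl.integrable_smul_left_of_hasCompactSupport hdc hc.deriv
  have hi' := hl'.integrable_smul_left_of_hasCompactSupport hψ.continuous hc
  have hts : tsupport (fun x => ψ (-x)) = -tsupport ψ :=
    tsupport_comp_eq_preimage ψ (Homeomorph.neg ℝ)
  have e1 := integral_Ioi_deriv_smul (fun X hX => hp.isPrimitive hX) hψ hc h0
  have e2 := integral_Ioi_deriv_smul (fun X hX => hq.isPrimitive hX)
    (ψ := fun x => ψ (-x)) (hψ.comp contDiff_neg)
    (hc.comp_homeomorph (Homeomorph.neg ℝ)) (by rw [hts]; simpa using h0)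
  have hd : ∀ x, deriv (fun x => ψ (-x)) x = -deriv ψ (-x) := fun x => deriv_comp_neg ψ x
  simp only [hd, neg_smul, integral_neg, neg_inj] at e2
  have l1 : ∫ x in Iic (0 : ℝ), deriv ψ x • glue p q x
      = ∫ x in Ioi (0 : ℝ), deriv ψ (-x) • q x := by
    have := integral_comp_neg_Iic 0 (fun x => deriv ψ (-x) • q x)
    rw [neg_zero] at this
    rw [← this]
    refine setIntegral_congr_fun measurableSet_Iic fun x hx => ?_
    simp only [glue_of_nonpos p q hx, neg_neg]
  have l2 : ∫ x in Iic (0 : ℝ), ψ x • glue p' (fun x => -q' x) x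
      = -∫ x in Ioi (0 : ℝ), ψ (-x) • q' x := by
    have := integral_comp_neg_Iic 0 (fun x => ψ (-x) • q' x)
    rw [neg_zero] at this
    rw [← this, ← integral_neg]
    refine setIntegral_congr_fun measurableSet_Iic fun x hx => ?_
    simp only [glue_of_nonpos p' (fun x => -q' x) hx, neg_neg, smul_neg]
  have r1 : ∫ x in Ioi (0 : ℝ), deriv ψ x • glue p q x
      = ∫ x in Ioi (0 : ℝ), deriv ψ x • p x :=
    setIntegral_congr_fun measurableSet_Ioi fun x hx => by simp only [glue_of_pos p q hx]
  have r2 : ∫ x in Ioi (0 : ℝ), ψ x • glue p' (fun x => -q' x) x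
      = ∫ x in Ioi (0 : ℝ), ψ x • p' x :=
    setIntegral_congr_fun measurableSet_Ioi fun x hx => by
      simp only [glue_of_pos p' (fun x => -q' x) hx]
  rw [← intervalIntegral.integral_Iic_add_Ioi (b := 0) hi.integrableOn hi.integrableOn,
    ← intervalIntegral.integral_Iic_add_Ioi (b := 0) hi'.integrableOn hi'.integrableOn,
    l1, l2, r1, r2, e1, e2]
  ring

theorem memW_glue (hp : HalfLine p p') (hq : HalfLine q q') : MemW (glue p q) := by
  refine ⟨⟨memLp_glue hp.memLp hq.memLp, _, memLp_glue hp.memLp_deriv hq.memLp_deriv.neg,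
    isWeakDeriv_glue hp hq⟩, ?_⟩
  simp only [comp_glue fun z : ℂ => ‖z‖ ^ 2 * Real.log (‖z‖ ^ 2)]
  exact integrable_glue hp.entropy hq.entropy

theorem traceRight_glue (hp : HalfLine p p') : traceRight (glue p q) = p 0 := by
  refine traceRight_eq (Tendsto.mono_left ?_ inf_le_left)
  have h1 : Tendsto p (𝓝[>] 0) (𝓝 (p 0)) :=
    ((hp.continuousOn 0 self_mem_Ici).mono Ioi_subset_Ici_self).tendsto
  refine h1.congr' ?_
  filter_upwards [self_mem_nhdsWithin] with x hx using (glue_of_pos p q hx).symm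

theorem traceLeft_glue (hq : HalfLine q q') : traceLeft (glue p q) = q 0 := by
  refine traceLeft_eq (Tendsto.mono_left ?_ inf_le_left)
  have h1 : Tendsto q (𝓝[>] 0) (𝓝 (q 0)) :=
    ((hq.continuousOn 0 self_mem_Ici).mono Ioi_subset_Ici_self).tendsto
  have h2 : Tendsto (fun x : ℝ => -x) (𝓝[<] 0) (𝓝[>] 0) := by
    simpa using tendsto_neg_nhdsLT (a := (0 : ℝ))
  refine (h1.comp h2).congr' ?_
  filter_upwards [self_mem_nhdsWithin] with x hx using (glue_of_nonpos p q (le_of_lt hx)).symm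

theorem integral_norm_sq_glue (hp : HalfLine p p') (hq : HalfLine q q') :
    ∫ x, ‖glue p q x‖ ^ 2 = tail p 0 + tail q 0 := by
  simp only [comp_glue fun z : ℂ => ‖z‖ ^ 2]
  exact integral_glue hp.integrableOn_sq hq.integrableOn_sq

theorem form_glue (γ : ℝ) (hp : HalfLine p p') (hq : HalfLine q q') :
    form γ (glue p q) (glue p q) = kinetic p' + kinetic q' - γ⁻¹ * ‖p 0 - q 0‖ ^ 2 := by
  have hw := weakDeriv_ae_eq (memLp_glue hp.memLp_deriv hq.memLp_deriv.neg)
    (isWeakDeriv_glue hp hq)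
  have hk : (∫ x, weakDeriv (glue p q) x * (starRingEnd ℂ) (weakDeriv (glue p q) x)).re =
      kinetic p' + kinetic q' := by
    have h1 : (∫ x, weakDeriv (glue p q) x * (starRingEnd ℂ) (weakDeriv (glue p q) x)) =
        ((∫ x, ‖glue p' (fun x => -q' x) x‖ ^ 2 : ℝ) : ℂ) := by
      rw [← integral_complex_ofReal]
      refine integral_congr_ae ?_
      filter_upwards [hw] with x hx
      rw [hx, Complex.mul_conj, Complex.normSq_eq_norm_sq]
      rfl
    rw [h1, Complex.ofReal_re]
    simp only [comp_glue fun z : ℂ => ‖z‖ ^ 2, norm_neg]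
    exact integral_glue hp.integrableOn_deriv_sq hq.integrableOn_deriv_sq
  rw [form, hk, jump, traceRight_glue hp, traceLeft_glue hq, Complex.mul_conj, Complex.ofReal_re,
    Complex.normSq_eq_norm_sq]

theorem nehari_glue (ω γ : ℝ) (hp : HalfLine p p') (hq : HalfLine q q') :
    nehari ω γ (glue p q) = energy p p' + energy q q' + ω * (tail p 0 + tail q 0)
      - γ⁻¹ * ‖p 0 - q 0‖ ^ 2 := by
  have he : ∫ x, ‖glue p q x‖ ^ 2 * Real.log (‖glue p q x‖ ^ 2) =
      (∫ x in Ioi (0 : ℝ), ‖p x‖ ^ 2 * Real.log (‖p x‖ ^ 2)) +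
      ∫ x in Ioi (0 : ℝ), ‖q x‖ ^ 2 * Real.log (‖q x‖ ^ 2) := by
    simp only [comp_glue fun z : ℂ => ‖z‖ ^ 2 * Real.log (‖z‖ ^ 2)]
    exact integral_glue hp.entropy hq.entropy
  rw [nehari, form_glue γ hp hq, integral_norm_sq_glue hp hq, he, energy, energy]
  ring

end Glue

section Congr
variable {u v : ℝ → ℂ}

theorem isWeakDeriv_congr (h : u =ᵐ[volume] v) : IsWeakDeriv u = IsWeakDeriv v := by
  funext g
  have e : ∀ ψ : ℝ → ℝ, ∫ x, deriv ψ x • u x = ∫ x, deriv ψ x • v x := fun ψ =>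
    integral_congr_ae (h.mono fun x hx => by simp only [hx])
  simp only [IsWeakDeriv, e]

theorem jump_congr (h : u =ᵐ[volume] v) : jump u = jump v := by
  have h1 : ∀ l : Filter ℝ, limUnder (l ⊓ ae volume) u = limUnder (l ⊓ ae volume) v := fun l => by
    rw [limUnder, limUnder, map_congr (EventuallyEq.filter_mono h inf_le_right)]
  rw [jump, jump, traceRight, traceRight, traceLeft, traceLeft, h1, h1]

theorem nehari_congr (h : u =ᵐ[volume] v) (ω γ : ℝ) : nehari ω γ u = nehari ω γ v := by
  have h1 : ∫ x, ‖u x‖ ^ 2 = ∫ x, ‖v x‖ ^ 2 :=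
    integral_congr_ae (h.mono fun x hx => by simp only [hx])
  have h2 : ∫ x, ‖u x‖ ^ 2 * Real.log (‖u x‖ ^ 2) = ∫ x, ‖v x‖ ^ 2 * Real.log (‖v x‖ ^ 2) :=
    integral_congr_ae (h.mono fun x hx => by simp only [hx])
  have h3 : weakDeriv u = weakDeriv v := by
    unfold weakDeriv
    rw [isWeakDeriv_congr h]
  rw [nehari, nehari, form, form, h1, h2, h3, jump_congr h]

end Congr

/-- The Nehari functional in terms of the two half lines. -/
noncomputable def pairNehari (ω γ : ℝ) (p p' q q' : ℝ → ℂ) : ℝ :=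
  energy p p' + energy q q' + ω * (tail p 0 + tail q 0) - γ⁻¹ * ‖p 0 - q 0‖ ^ 2

theorem pairNehari_const_mul (ω γ : ℝ) {p p' q q' : ℝ → ℂ} (hp : HalfLine p p')
    (hq : HalfLine q q') (c : ℂ) :
    pairNehari ω γ (fun x => c * p x) (fun x => c * p' x) (fun x => c * q x)
      (fun x => c * q' x) = ‖c‖ ^ 2 * (pairNehari ω γ p p' q q'
        - Real.log (‖c‖ ^ 2) * (tail p 0 + tail q 0)) := by
  rw [pairNehari, hp.energy_const_mul, hq.energy_const_mul, tail_const_mul, tail_const_mul,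
    ← mul_sub, norm_mul, mul_pow, pairNehari]
  ring

/-- `(p, q)` are the two halves of a ground state. -/
structure IsGroundPair (ω γ : ℝ) (p p' q q' : ℝ → ℂ) : Prop where
  fst : HalfLine p p'
  snd : HalfLine q q'
  mass_pos : 0 < tail p 0 + tail q 0
  nehari_eq : pairNehari ω γ p p' q q' = 0
  le_of_nehari : ∀ r r' s s', HalfLine r r' → HalfLine s s' → 0 < tail r 0 + tail s 0 →
    pairNehari ω γ r r' s s' = 0 → tail p 0 + tail q 0 ≤ tail r 0 + tail s 0

theorem not_ae_zero_of_pos {u : ℝ → ℂ} (h : 0 < ∫ x, ‖u x‖ ^ 2) : ¬ u =ᵐ[volume] 0 := by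
  intro h0
  have : ∫ x, ‖u x‖ ^ 2 = 0 := integral_eq_zero_of_ae (h0.mono fun x hx => by simp [hx])
  exact h.ne' this

theorem exists_isGroundPair {ω γ : ℝ} {u : ℝ → ℂ} (hu : u ∈ groundStates ω γ) :
    ∃ p p' q q', IsGroundPair ω γ p p' q q' ∧ u =ᵐ[volume] glue p q := by
  obtain ⟨hW, h0, hact, hneh⟩ := hu
  obtain ⟨p, p', q, q', hp, hq, hae⟩ := hW.exists_glue
  have hmass : ∫ x, ‖u x‖ ^ 2 = tail p 0 + tail q 0 := by
    rw [← integral_norm_sq_glue hp hq]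
    exact integral_congr_ae (hae.mono fun x hx => by simp only [hx])
  refine ⟨p, p', q, q', ⟨hp, hq, ?_, ?_, ?_⟩, hae⟩
  · rw [← hmass]
    refine lt_of_le_of_ne (by positivity) fun h => h0 ?_
    have hi : Integrable (fun x => ‖u x‖ ^ 2) := hW.1.1.integrable_norm_pow (by norm_num)
    have := (integral_eq_zero_iff_of_nonneg (fun x => by positivity) hi).1 h.symm
    filter_upwards [this] with x hx
    simpa using hx
  · rw [← hneh, nehari_congr hae, nehari_glue ω γ hp hq, pairNehari]
  · intro r r' s s' hr hs hpos hzero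
    have hmem : glue r s ∈ nehariManifold ω γ :=
      ⟨memW_glue hr hs, not_ae_zero_of_pos (by rwa [integral_norm_sq_glue hr hs]), by
        rw [nehari_glue ω γ hr hs]; exact hzero⟩
    have hle : groundLevel ω γ ≤ action ω γ (glue r s) :=
      csInf_le ⟨0, by rintro _ ⟨v, hv, rfl⟩; exact action_nonneg hv⟩ ⟨_, hmem, rfl⟩
    rw [← hact, action_eq_of_nehari hneh, action_eq_of_nehari hmem.2.2, hmass,
      integral_norm_sq_glue hr hs] at hle
    linarith

/-- The minimality of a ground state, freed from the constraint by scaling. -/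
theorem IsGroundPair.le_pairNehari {ω γ : ℝ} {p p' q q' : ℝ → ℂ}
    (h : IsGroundPair ω γ p p' q q') {r r' s s' : ℝ → ℂ} (hr : HalfLine r r')
    (hs : HalfLine s s') (hpos : 0 < tail r 0 + tail s 0) :
    (tail r 0 + tail s 0) * Real.log ((tail p 0 + tail q 0) / (tail r 0 + tail s 0)) ≤
      pairNehari ω γ r r' s s' := by
  set M := tail r 0 + tail s 0 with hM
  set I := pairNehari ω γ r r' s s'
  set c : ℂ := ((Real.exp (I / M / 2) : ℝ) : ℂ)
  have hc : ‖c‖ ^ 2 = Real.exp (I / M) := by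
    rw [Complex.norm_real, Real.norm_of_nonneg (Real.exp_pos _).le, ← Real.exp_nat_mul]
    congr 1; push_cast; ring
  have h1 := h.le_of_nehari _ _ _ _ (hr.const_mul c) (hs.const_mul c)
    (by rw [tail_const_mul, tail_const_mul, ← mul_add, hc]; positivity)
    (by
      rw [pairNehari_const_mul ω γ hr hs, hc, Real.log_exp, ← hM, div_mul_cancel₀ _ hpos.ne',
        sub_self, mul_zero])
  rw [tail_const_mul, tail_const_mul, ← mul_add, hc, ← hM] at h1
  have h2 : Real.log ((tail p 0 + tail q 0) / M) ≤ I / M := by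
    rw [Real.log_le_iff_le_exp (div_pos h.mass_pos hpos), div_le_iff₀ hpos]
    exact h1
  rwa [le_div_iff₀' hpos] at h2

theorem HalfLine.zero : HalfLine (fun x => (0 : ℂ) * gauss 0 x) (fun x => (0 : ℂ) * gaussDeriv 0 x) :=
  (halfLine_gauss 0).const_mul 0

theorem HalfLine.eq_zero_of_tail_eq_zero {q q' : ℝ → ℂ} (h : HalfLine q q')
    (h0 : tail q 0 = 0) {x : ℝ} (hx : 0 ≤ x) : q x = 0 := by
  have h1 : tail q x = 0 := le_antisymm ((h.tail_anti le_rfl hx).trans h0.le) (tail_nonneg q x)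
  have h2 := h.sq_sq_le hx
  rw [h1, mul_zero] at h2
  have h3 : (‖q x‖ ^ 2) ^ 2 = 0 := le_antisymm h2 (by positivity)
  simpa using h3

theorem HalfLine.energy_nonneg_of_tail_eq_zero {q q' : ℝ → ℂ} (h : HalfLine q q')
    (h0 : tail q 0 = 0) : 0 ≤ energy q q' := by
  have : ∫ x in Ioi (0 : ℝ), ‖q x‖ ^ 2 * Real.log (‖q x‖ ^ 2) = 0 :=
    setIntegral_eq_zero_of_forall_eq_zero fun x hx => by
      simp [h.eq_zero_of_tail_eq_zero h0 (le_of_lt hx)]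
  rw [energy, this, sub_zero]
  exact kinetic_nonneg q'

theorem exists_amplitude (t : ℝ) {m : ℝ} (hm : 0 < m) :
    ∃ c : ℝ, 0 < c ∧ c ^ 2 * t ^ 2 = m * tailRatio t ∧
      ∀ z : ℂ, ‖z‖ = c → tail (fun x => z * gauss t x) 0 = m := by
  have hG := gaussTail_pos t
  have hpos : 0 < m / (Real.exp (t ^ 2) * gaussTail t) := by positivity
  refine ⟨√(m / (Real.exp (t ^ 2) * gaussTail t)), Real.sqrt_pos.2 hpos, ?_, fun z hz => ?_⟩
  · rw [Real.sq_sqrt hpos.le, tailRatio, Real.exp_neg]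
    field_simp
  · rw [tail_const_mul, hz, Real.sq_sqrt hpos.le, tail_gauss]
    field_simp

theorem balanced_form {γ t₁ t₂ : ℝ} (h₁ : 0 < t₁) (h₂ : 0 < t₂) (h : t₁⁻¹ + t₂⁻¹ = γ) (a b : ℂ) :
    t₁ * ‖a‖ ^ 2 + t₂ * ‖b‖ ^ 2 - γ⁻¹ * ‖a - b‖ ^ 2 = ‖t₁ * a + t₂ * b‖ ^ 2 / (t₁ + t₂) := by
  have hγ : γ⁻¹ = t₁ * t₂ / (t₁ + t₂) := by
    rw [← h]; field_simp; ring
  rw [hγ]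
  simp only [← Complex.normSq_eq_norm_sq, Complex.normSq_apply, Complex.mul_re,
    Complex.mul_im, Complex.add_re, Complex.add_im, Complex.sub_re, Complex.sub_im,
    Complex.ofReal_re, Complex.ofReal_im]
  field_simp
  ring

namespace IsGroundPair
variable {ω γ : ℝ} {p p' q q' : ℝ → ℂ}

theorem swap (h : IsGroundPair ω γ p p' q q') : IsGroundPair ω γ q q' p p' where
  fst := h.snd
  snd := h.fst
  mass_pos := by rw [add_comm]; exact h.mass_pos
  nehari_eq := by
    rw [← h.nehari_eq, pairNehari, pairNehari, norm_sub_rev]; ring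
  le_of_nehari := fun r r' s s' hr hs hpos hz => by
    have := h.le_of_nehari s s' r r' hs hr (by rwa [add_comm])
      (by rw [← hz, pairNehari, pairNehari, norm_sub_rev]; ring)
    linarith

theorem trace_ne_zero_of_tail_eq_zero (h : IsGroundPair ω γ p p' q q') (hγ : 0 < γ)
    (hq : tail q 0 = 0) : p 0 ≠ 0 := by
  intro ha
  have hm : 0 < tail p 0 := by simpa [hq] using h.mass_pos
  have hq0 := h.snd.eq_zero_of_tail_eq_zero hq le_rfl
  have hE := h.snd.energy_nonneg_of_tail_eq_zero hq
  have hn := h.nehari_eq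
  rw [pairNehari, hq, hq0, ha, sub_zero, norm_zero] at hn
  have hlow := h.fst.le_energy hm 0
  obtain ⟨c, hc, -, hct⟩ := exists_amplitude γ⁻¹ hm
  have hcn : ‖(c : ℂ)‖ = c := by rw [Complex.norm_real, Real.norm_of_nonneg hc.le]
  have hcm := hct c hcn
  have hmin := h.le_pairNehari ((halfLine_gauss γ⁻¹).const_mul c) HalfLine.zero
    (by rw [hcm, tail_const_mul]; simpa using hm)
  rw [pairNehari, hcm, energy_const_mul_gauss (Complex.ofReal_ne_zero.2 hc.ne') γ⁻¹ hcm,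
    (halfLine_gauss 0).energy_const_mul, tail_const_mul, hq, gauss_zero, hcn] at hmin
  simp [div_self hm.ne'] at hmin
  have hG : gaussTail γ⁻¹ / tail p 0 < gaussTail 0 / tail p 0 :=
    div_lt_div_of_pos_right (strictAnti_gaussTail (inv_pos.2 hγ)) hm
  have hlog := Real.log_lt_log (div_pos (gaussTail_pos _) hm) hG
  nlinarith [mul_lt_mul_of_pos_right hlog hm]

theorem tail_right_pos (h : IsGroundPair ω γ p p' q q') (hγ : 0 < γ) : 0 < tail q 0 := by
  refine lt_of_le_of_ne (tail_nonneg q 0) fun hq => ?_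
  have hq : tail q 0 = 0 := hq.symm
  have hm : 0 < tail p 0 := by simpa [hq] using h.mass_pos
  have ha := h.trace_ne_zero_of_tail_eq_zero hγ hq
  have hq0 := h.snd.eq_zero_of_tail_eq_zero hq le_rfl
  have hE := h.snd.energy_nonneg_of_tail_eq_zero hq
  have hn := h.nehari_eq
  rw [pairNehari, hq, hq0, sub_zero] at hn
  set m := tail p 0 with hm_def
  set A := ‖p 0‖ ^ 2 with hA_def
  set T := tail (gauss 0) 0
  set E := energy (gauss 0) (gaussDeriv 0)
  have hA : 0 < A := by positivity
  have hT : 0 ≤ T := tail_nonneg _ _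
  let k : ℝ → ℝ := fun ε => ε * (E + ω * T) - T * (2 * (ε * Real.log ε) + ε * Real.log A)
    - γ⁻¹ * (2 + ε) + (m + ε ^ 2 * A * T) * (ε * T) / m
  have hk : Continuous k := by
    have := Real.continuous_mul_log
    fun_prop
  have hk0 : k 0 = -(2 * γ⁻¹) := by simp [k]; ring
  have hpos : ∀ᶠ ε in 𝓝[>] (0 : ℝ), 0 ≤ k ε := by
    filter_upwards [self_mem_nhdsWithin] with ε hε
    have hε : 0 < ε := hε
    have hcn : ‖-(ε : ℂ) * p 0‖ ^ 2 = ε ^ 2 * A := by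
      rw [norm_mul, norm_neg, Complex.norm_real, mul_pow, Real.norm_eq_abs, sq_abs]
    have hjump : ‖p 0 - -(ε : ℂ) * p 0 * gauss 0 0‖ ^ 2 = (1 + ε) ^ 2 * A := by
      have : p 0 - -(ε : ℂ) * p 0 * gauss 0 0 = ((1 + ε : ℝ) : ℂ) * p 0 := by
        rw [gauss_zero]; push_cast; ring
      rw [this, norm_mul, Complex.norm_real, mul_pow, Real.norm_eq_abs, sq_abs]
    have hN : 0 ≤ ε ^ 2 * A * T := by positivity
    have hM : 0 < m + ε ^ 2 * A * T := by positivity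
    have hmin := h.le_pairNehari h.fst ((halfLine_gauss 0).const_mul (-(ε : ℂ) * p 0))
      (by rw [tail_const_mul, hcn]; exact hM)
    rw [pairNehari, hjump, (halfLine_gauss 0).energy_const_mul, tail_const_mul, hcn, hq, add_zero,
      ← hm_def, Real.log_mul (by positivity) hA.ne', Real.log_pow] at hmin
    have hlog : -(ε ^ 2 * A * T / m) ≤ Real.log (m / (m + ε ^ 2 * A * T)) := by
      have := Real.one_sub_inv_le_log_of_pos (div_pos hm hM)
      rw [inv_div] at this
      refine le_trans (le_of_eq ?_) this
      field_simp; ring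
    have h1 := mul_le_mul_of_nonneg_left hlog hM.le
    have h2 : 0 ≤ ε * A * k ε := by
      have e : ε * A * k ε = ε ^ 2 * A * E - ε ^ 2 * A * (2 * Real.log ε + Real.log A) * T
          + ω * (ε ^ 2 * A * T) - γ⁻¹ * ((1 + ε) ^ 2 * A) + γ⁻¹ * A
          + (m + ε ^ 2 * A * T) * (ε ^ 2 * A * T / m) := by
        simp only [k]; field_simp; ring
      rw [e]
      push_cast at hmin
      linarith
    exact nonneg_of_mul_nonneg_right h2 (by positivity)
  have := ge_of_tendsto (hk.continuousAt.tendsto.mono_left nhdsWithin_le_nhds) hpos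
  rw [hk0] at this
  have := inv_pos.2 hγ
  linarith

/-- The Euler–Lagrange identity obtained by varying the amplitude of one half. -/
theorem energy_add_mass_eq (h : IsGroundPair ω γ p p' q q') (hm : 0 < tail p 0) {s : ℝ}
    (hs : q 0 = -(s * p 0)) :
    energy p p' + ω * tail p 0 = γ⁻¹ * (1 + s) * ‖p 0‖ ^ 2 := by
  set m := tail p 0 with hm_def
  set n := tail q 0 with hn_def
  have hn : 0 ≤ n := tail_nonneg q 0
  set A := ‖p 0‖ ^ 2 with hA
  let k : ℝ → ℝ := fun x => x ^ 2 * energy p p' - x ^ 2 * Real.log (x ^ 2) * m + energy q q'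
    + ω * (x ^ 2 * m + n) - γ⁻¹ * ((x + s) ^ 2 * A)
    - (x ^ 2 * m + n) * Real.log ((m + n) / (x ^ 2 * m + n))
  have hjump : ∀ x : ℝ, ‖(x : ℂ) * p 0 - q 0‖ ^ 2 = (x + s) ^ 2 * A := by
    intro x
    have : (x : ℂ) * p 0 - q 0 = ((x + s : ℝ) : ℂ) * p 0 := by rw [hs]; push_cast; ring
    rw [this, norm_mul, Complex.norm_real, mul_pow, Real.norm_eq_abs, sq_abs]
  have hk1 : k 1 = 0 := by
    have h1 := h.nehari_eq
    have h2 := hjump 1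
    rw [Complex.ofReal_one, one_mul] at h2
    rw [pairNehari, h2] at h1
    have h3 : m + n ≠ 0 := by positivity
    simp only [k, one_pow, one_mul, Real.log_one, div_self h3]
    linarith
  have hmin : IsLocalMin k 1 := by
    filter_upwards [lt_mem_nhds one_pos] with x hx
    rw [hk1]
    have hcn : ‖(x : ℂ)‖ ^ 2 = x ^ 2 := by rw [Complex.norm_real, Real.norm_eq_abs, sq_abs]
    have h1 := h.le_pairNehari (h.fst.const_mul x) h.snd
      (by rw [tail_const_mul, hcn]; positivity)
    rw [pairNehari, hjump, h.fst.energy_const_mul, tail_const_mul, hcn] at h1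
    simp only [k]
    linarith
  have hsq : HasDerivAt (fun x : ℝ => x ^ 2) 2 1 := by simpa using hasDerivAt_pow 2 (1 : ℝ)
  have hlog : HasDerivAt (fun x : ℝ => Real.log (x ^ 2)) 2 1 := by
    simpa using hsq.log (by norm_num)
  have hM : HasDerivAt (fun x : ℝ => x ^ 2 * m + n) (2 * m) 1 := (hsq.mul_const m).add_const n
  have hMpos : 0 < (1 : ℝ) ^ 2 * m + n := by positivity
  have hquot := ((hasDerivAt_const (1 : ℝ) (m + n)).div hM hMpos.ne').log
    (div_pos (by positivity) hMpos).ne'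
  have hs2 : HasDerivAt (fun x : ℝ => (x + s) ^ 2) (2 * (1 + s)) 1 := by
    exact (((hasDerivAt_id (1 : ℝ)).add_const s).pow 2).congr_deriv (by simp)
  have hd := ((((hsq.mul_const (energy p p')).sub ((hsq.mul hlog).mul_const m)).add_const
    (energy q q')).add (hM.const_mul ω)).sub ((hs2.mul_const A).const_mul γ⁻¹) |>.sub
    (hM.mul hquot)
  have h0 := hmin.hasDerivAt_eq_zero hd
  have h3 : m + n ≠ 0 := by positivity
  simp only [Pi.div_apply, one_pow, one_mul, Real.log_one, div_self h3] at h0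
  field_simp at h0
  field_simp
  linarith

/-- The two halves of a ground state are balanced Gaussians. -/
theorem exists_gaussians (h : IsGroundPair ω γ p p' q q') (hγ : 0 < γ) :
    ∃ t₁ t₂ : ℝ, 0 < t₁ ∧ 0 < t₂ ∧ t₁⁻¹ + t₂⁻¹ = γ ∧ t₁ * p 0 + t₂ * q 0 = 0 ∧
      (∀ x, 0 ≤ x → p x = p 0 * gauss t₁ x) ∧ (∀ x, 0 ≤ x → q x = q 0 * gauss t₂ x) ∧
      energy p p' = (1 + Real.log (gaussTail t₁ / tail p 0)) * tail p 0 + t₁ * ‖p 0‖ ^ 2 ∧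
      energy q q' = (1 + Real.log (gaussTail t₂ / tail q 0)) * tail q 0 + t₂ * ‖q 0‖ ^ 2 := by
  have hm := h.swap.tail_right_pos hγ
  have hn := h.tail_right_pos hγ
  obtain ⟨t₁, t₂, h₁, h₂, hγt, hbal⟩ := exists_balanced hγ hm hn
  obtain ⟨c, hc, hc2, hct⟩ := exists_amplitude t₁ hm
  obtain ⟨d, hd, hd2, hdt⟩ := exists_amplitude t₂ hn
  have hcd : c * t₁ = d * t₂ := by
    have : (c * t₁) ^ 2 = (d * t₂) ^ 2 := by rw [mul_pow, mul_pow, hc2, hd2, hbal]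
    exact (pow_left_inj₀ (by positivity) (by positivity) two_ne_zero).1 this
  have hcn : ‖(c : ℂ)‖ = c := by rw [Complex.norm_real, Real.norm_of_nonneg hc.le]
  have hdn : ‖(-d : ℂ)‖ = d := by rw [norm_neg, Complex.norm_real, Real.norm_of_nonneg hd.le]
  have hmin := h.le_pairNehari ((halfLine_gauss t₁).const_mul c)
    ((halfLine_gauss t₂).const_mul (-d : ℂ)) (by rw [hct c hcn, hdt _ hdn]; positivity)
  rw [pairNehari, energy_const_mul_gauss (Complex.ofReal_ne_zero.2 hc.ne') t₁ (hct c hcn),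
    energy_const_mul_gauss (neg_ne_zero.2 (Complex.ofReal_ne_zero.2 hd.ne')) t₂ (hdt _ hdn),
    hct c hcn, hdt _ hdn, div_self h.mass_pos.ne', Real.log_one, mul_zero, gauss_zero,
    gauss_zero, mul_one, mul_one] at hmin
  have hform := balanced_form h₁ h₂ hγt c (-d : ℂ)
  have hnull : (t₁ : ℂ) * c + t₂ * (-d : ℂ) = 0 := by
    have : (c : ℂ) * t₁ = d * t₂ := by exact_mod_cast hcd
    linear_combination this
  rw [hnull, norm_zero, zero_pow two_ne_zero, zero_div] at hform
  have hpq := balanced_form h₁ h₂ hγt (p 0) (q 0)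
  have hsq : 0 ≤ ‖t₁ * p 0 + t₂ * q 0‖ ^ 2 / (t₁ + t₂) := by positivity
  have hneh := h.nehari_eq
  rw [pairNehari] at hneh
  have hp := h.fst.le_energy hm t₁
  have hq := h.snd.le_energy hn t₂
  have hz : ‖t₁ * p 0 + t₂ * q 0‖ ^ 2 / (t₁ + t₂) = 0 := by linarith
  refine ⟨t₁, t₂, h₁, h₂, hγt, ?_, h.fst.eq_gaussian_of_energy_le hm t₁ (by linarith),
    h.snd.eq_gaussian_of_energy_le hn t₂ (by linarith), by linarith, by linarith⟩
  have h3 : t₁ + t₂ ≠ 0 := by positivity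
  simpa [h3] using hz

end IsGroundPair

theorem norm_eq_of_stationary {ω t : ℝ} {p p' : ℝ → ℂ} (hm : 0 < tail p 0)
    (hp : ∀ x, 0 ≤ x → p x = p 0 * gauss t x)
    (he : energy p p' = (1 + Real.log (gaussTail t / tail p 0)) * tail p 0 + t * ‖p 0‖ ^ 2)
    (hst : energy p p' + ω * tail p 0 = t * ‖p 0‖ ^ 2) :
    ‖p 0‖ = Real.exp ((ω + 1) / 2) * Real.exp (-(1 / 2) * t ^ 2) := by
  have hG := gaussTail_pos t
  have htail : tail p 0 = ‖p 0‖ ^ 2 * (Real.exp (t ^ 2) * gaussTail t) := by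
    rw [← tail_gauss, ← tail_const_mul]
    exact setIntegral_congr_fun measurableSet_Ioi fun x hx => by
      simp only [hp x (le_of_lt hx)]
  have hA : 0 < ‖p 0‖ := by
    rw [norm_pos_iff]
    intro h0
    simp [htail, h0] at hm
  have hlog : 1 + Real.log (gaussTail t / tail p 0) + ω = 0 := by
    have : (1 + Real.log (gaussTail t / tail p 0) + ω) * tail p 0 = 0 := by linarith
    exact (mul_eq_zero.1 this).resolve_right hm.ne'
  rw [htail, show gaussTail t / (‖p 0‖ ^ 2 * (Real.exp (t ^ 2) * gaussTail t)) =
      (‖p 0‖ ^ 2 * Real.exp (t ^ 2))⁻¹ by field_simp, Real.log_inv,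
    Real.log_mul (by positivity) (Real.exp_pos _).ne', Real.log_exp, Real.log_pow] at hlog
  rw [← Real.exp_add, ← Real.exp_log hA]
  congr 1
  push_cast at hlog
  linarith

end LogNLS

theorem proposition1p2 (γ ω : ℝ) (hγ : 0 < γ) (u : ℝ → ℂ)
    (hu : u ∈ LogNLS.groundStates ω γ) :
    ∃ θ t₁ t₂ : ℝ, 0 < t₁ ∧ 0 < t₂ ∧
      t₁ * Real.exp (-(1 / 2) * t₁ ^ 2) = t₂ * Real.exp (-(1 / 2) * t₂ ^ 2) ∧
      t₁⁻¹ + t₂⁻¹ = γ ∧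
      u =ᵐ[MeasureTheory.volume]
        fun x => Complex.exp (θ * Complex.I) * (LogNLS.profile ω t₁ t₂ x : ℂ) := by
  obtain ⟨p, p', q, q', hg, hae⟩ := LogNLS.exists_isGroundPair hu
  obtain ⟨t₁, t₂, h₁, h₂, hγt, hnull, hp, hq, hep, heq⟩ := hg.exists_gaussians hγ
  have hm := hg.swap.tail_right_pos hγ
  have hn := hg.tail_right_pos hγ
  have ht₁ : (t₁ : ℂ) ≠ 0 := Complex.ofReal_ne_zero.2 h₁.ne'
  have ht₂ : (t₂ : ℂ) ≠ 0 := Complex.ofReal_ne_zero.2 h₂.ne'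
  have hqp : q 0 = -((t₁ / t₂ : ℝ) * p 0) := by
    push_cast; field_simp; linear_combination hnull
  have hpq : p 0 = -((t₂ / t₁ : ℝ) * q 0) := by
    push_cast; field_simp; linear_combination hnull
  have hinv₁ : γ⁻¹ * (1 + t₁ / t₂) = t₁ := by rw [← hγt]; field_simp
  have hinv₂ : γ⁻¹ * (1 + t₂ / t₁) = t₂ := by rw [← hγt]; field_simp; ring
  have hp0 := LogNLS.norm_eq_of_stationary (ω := ω) hm hp hep
    (by rw [hg.energy_add_mass_eq hm hqp, hinv₁])
  have hq0 := LogNLS.norm_eq_of_stationary (ω := ω) hn hq heq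
    (by rw [hg.swap.energy_add_mass_eq hn hpq, hinv₂])
  have hnorm : t₁ * ‖p 0‖ = t₂ * ‖q 0‖ := by
    rw [hqp, norm_neg, norm_mul, Complex.norm_real, Real.norm_of_nonneg (by positivity)]
    field_simp
  obtain ⟨θ, hpolar⟩ : ∃ θ : ℝ, p 0 = Complex.exp (θ * Complex.I) * (‖p 0‖ : ℝ) :=
    ⟨(p 0).arg, by rw [mul_comm]; exact (Complex.norm_mul_exp_arg_mul_I (p 0)).symm⟩
  have hpolar' : q 0 = -(Complex.exp (θ * Complex.I) * (‖q 0‖ : ℝ)) := by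
    have e : ‖q 0‖ = t₁ / t₂ * ‖p 0‖ := by field_simp; linarith
    rw [e, hqp]
    nth_rewrite 1 [hpolar]
    push_cast; ring
  refine ⟨θ, t₁, t₂, h₁, h₂, ?_, hγt, ?_⟩
  · rw [hp0, hq0] at hnorm
    have := Real.exp_pos ((ω + 1) / 2)
    apply mul_left_cancel₀ this.ne'
    linarith
  · filter_upwards [hae] with x hx
    rw [hx]
    rcases lt_or_ge 0 x with hx0 | hx0
    · rw [LogNLS.glue_of_pos _ _ hx0, hp x hx0.le, hpolar, LogNLS.profile, if_pos hx0, mul_assoc,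
        LogNLS.gauss, ← Complex.ofReal_mul, hp0, mul_assoc, ← Real.exp_add]
      congr 4
      ring
    · rw [LogNLS.glue_of_nonpos _ _ hx0, hq _ (neg_nonneg.2 hx0), hpolar', LogNLS.profile,
        if_neg (not_lt.2 hx0), LogNLS.gauss, neg_mul, mul_assoc, ← Complex.ofReal_mul, hq0,
        Complex.ofReal_neg, mul_neg, mul_assoc, ← Real.exp_add, mul_neg]
      congr 5
      ring
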